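/- Let $V$ and $W$ be infinite-dimensional complex vector spaces (of arbitrary dimension) with a non-degenerate bilinear pairing $\langle\cdot,\cdot\rangle : V\times W\to\mathbb{C}$; via the pairing we regard $W$ as a subspace of $V^*=\mathrm{Hom}_{\mathbb C}(V,\mathbb{C})$. Let $\mathfrak{gl}(V,W)$ be the Lie algebra (under the commutator) of the associative algebra $V\otimes W$ with product $(v\otimes w)(v'\otimes w')=\langle v',w\rangle\, v\otimes w'$, and let $\mathfrak{sl}(V,W)$ be the kernel of $\mathrm{tr}:\mathfrak{gl}(V,W)\to\mathbb{C}$, $\mathrm{tr}(v\otimes w)=\langle v,w\rangle$. A subalgebra $\mathfrak h$ of a complex Lie algebra $\mathfrak g$ is called a local Cartan subalgebra if there are a directed system $(\mathfrak g_\alpha)$ of finite-dimensional simple Lie subalgebras of $\mathfrak g$, with inclusions $\mathfrak g_\alpha\subset\mathfrak g_\beta$ for $\alpha\le\beta$ and $\mathfrak g=\varinjlim\mathfrak g_\alpha=\bigcup_\alpha\mathfrak g_\alpha$, and Cartan subalgebras $\mathfrak h_\alpha\subset\mathfrak g_\alpha$ such that $\mathfrak h_\alpha\subset\mathfrak h_\beta$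 for all $\alpha\le\beta$, and $\mathfrak h=\varinjlim\mathfrak h_\alpha=\bigcup_\alpha\mathfrak h_\alpha$. **Proposition.** The Lie algebra $\mathfrak{sl}(V,W)$ has a local Cartan subalgebra if and only if $V$ has a basis $\{v_\gamma\}$ such that $W=\mathrm{span}\{v_\gamma^*\}$, where $v_{\tilde\gamma}^*\in V^*$ are the dual functionals, $v_{\tilde\gamma}^*(v_\gamma)=\delta_{\tilde\gamma\gamma}$. In this case, every local Cartan subalgebra of $\mathfrak{sl}(V,W)$ is of the form $\mathrm{span}\{v_\gamma\otimes v_\gamma^*-v_{\tilde\gamma}\otimes v_{\tilde\gamma}^*\}_{\gamma,\tilde\gamma}$ for some basis $\{v_\gamma\}$ of $V$ such that $W=\mathrm{span}\{v_\gamma^*\}$. -/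

import Mathlib

open scoped TensorProduct

universe u v

noncomputable section

/-- The Lie algebra `gl(V, W)` of a pairing `p : V × W → ℂ`. The underlying vector space is
`V ⊗ W`; the algebra structure, which depends on `p`, is defined below. -/
def MackeyGL {V : Type u} {W : Type v} [AddCommGroup V] [Module ℂ V] [AddCommGroup W] [Module ℂ W]
    (_p : V →ₗ[ℂ] W →ₗ[ℂ] ℂ) : Type (max u v) :=
  V ⊗[ℂ] W

namespace MackeyGL

variable {V : Type u} {W : Type v} [AddCommGroup V] [Module ℂ V] [AddCommGroup W] [Module ℂ W]
variable (p : V →ₗ[ℂ] W →ₗ[ℂ] ℂ)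

instance instAddCommGroup : AddCommGroup (MackeyGL p) :=
  inferInstanceAs (AddCommGroup (V ⊗[ℂ] W))

instance instModule : Module ℂ (MackeyGL p) :=
  inferInstanceAs (Module ℂ (V ⊗[ℂ] W))

/-- The pure tensor `v ⊗ w`, as an element of `gl(V, W)`. -/
def tmul (v : V) (w : W) : MackeyGL p :=
  (v ⊗ₜ[ℂ] w : V ⊗[ℂ] W)

/-- The associative product on `V ⊗ W`: `(v ⊗ w) (v' ⊗ w') = p(v', w) (v ⊗ w')`. -/
def mulTensor : (V ⊗[ℂ] W) →ₗ[ℂ] (V ⊗[ℂ] W) →ₗ[ℂ] (V ⊗[ℂ] W) :=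
  TensorProduct.lift <| LinearMap.mk₂ ℂ
    (fun v w => TensorProduct.lift <| LinearMap.mk₂ ℂ (fun v' w' => p v' w • (v ⊗ₜ[ℂ] w'))
      (fun a b c => by simp [add_smul])
      (fun c a b => by simp [mul_smul])
      (fun a b c => by simp [TensorProduct.tmul_add])
      (fun c a b => by rw [TensorProduct.tmul_smul, smul_comm]))
    (fun a b c => by ext; simp [TensorProduct.add_tmul])
    (fun c a b => by
      ext v' w'
      simp [← TensorProduct.smul_tmul', smul_comm (p v' b) c])
    (fun a b c => by ext; simp [add_smul])
    (fun c a b => by ext; simp [mul_smul])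

/-- The trace `gl(V, W) → ℂ`, induced by the pairing: `tr (v ⊗ w) = p(v, w)`. -/
def tr : MackeyGL p →ₗ[ℂ] ℂ :=
  (TensorProduct.lift p : V ⊗[ℂ] W →ₗ[ℂ] ℂ)

theorem mulTensor_tmul (v v' : V) (w w' : W) :
    mulTensor p (v ⊗ₜ[ℂ] w) (v' ⊗ₜ[ℂ] w') = p v' w • (v ⊗ₜ[ℂ] w') := by
  simp [mulTensor]

theorem mulTensor_assoc (x y z : V ⊗[ℂ] W) :
    mulTensor p (mulTensor p x y) z = mulTensor p x (mulTensor p y z) := by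
  induction x with
  | zero => simp
  | add a b ha hb => simp only [map_add, LinearMap.add_apply, ha, hb]
  | tmul v w =>
    induction y with
    | zero => simp
    | add a b ha hb => simp only [map_add, LinearMap.add_apply, ha, hb]
    | tmul v' w' =>
      induction z with
      | zero => simp
      | add a b ha hb => simp only [map_add, ha, hb]
      | tmul v'' w'' => simp [mulTensor_tmul, smul_smul, mul_comm]

theorem lift_mulTensor_comm (x y : V ⊗[ℂ] W) :
    TensorProduct.lift p (mulTensor p x y) = TensorProduct.lift p (mulTensor p y x) := by
  induction x with
  | zero => simp
  | add a b ha hb => simp only [map_add, LinearMap.add_apply, ha, hb]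
  | tmul v w =>
    induction y with
    | zero => simp
    | add a b ha hb => simp only [map_add, LinearMap.add_apply, ha, hb]
    | tmul v' w' => simp [mulTensor_tmul, mul_comm]

/-- The associative product `x y` of `gl(V, W)`, as a bilinear map on `gl(V, W)`. -/
def mul : MackeyGL p →ₗ[ℂ] MackeyGL p →ₗ[ℂ] MackeyGL p :=
  mulTensor p

theorem mul_tmul_tmul (v v' : V) (w w' : W) :
    mul p (tmul p v w) (tmul p v' w') = p v' w • tmul p v w' :=
  mulTensor_tmul p v v' w w'

theorem mul_assoc' (x y z : MackeyGL p) : mul p (mul p x y) z = mul p x (mul p y z) :=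
  mulTensor_assoc p x y z

theorem tr_tmul (v : V) (w : W) : tr p (tmul p v w) = p v w :=
  TensorProduct.lift.tmul v w

theorem tr_mul_comm (x y : MackeyGL p) : tr p (mul p x y) = tr p (mul p y x) :=
  lift_mulTensor_comm p x y

/-- The Lie bracket of `gl(V, W)` is the commutator `x y - y x` of the associative product. -/
instance instLieRing : LieRing (MackeyGL p) where
  bracket x y := mul p x y - mul p y x
  add_lie x y z := by
    simp only [map_add, LinearMap.add_apply]; abel
  lie_add x y z := by
    simp only [map_add, LinearMap.add_apply]; abel
  lie_self x := sub_self (mul p x x)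
  leibniz_lie x y z := by
    simp only [map_sub, LinearMap.sub_apply, mul_assoc']
    abel

theorem lie_eq (x y : MackeyGL p) : ⁅x, y⁆ = mul p x y - mul p y x :=
  rfl

instance instLieAlgebra : LieAlgebra ℂ (MackeyGL p) where
  lie_smul c x y := by
    simp only [lie_eq, map_smul, LinearMap.smul_apply, smul_sub]

end MackeyGL

/-- The Lie algebra `sl(V, W)`: the kernel of the trace on `gl(V, W)`. -/
def MackeySL {V : Type u} {W : Type v} [AddCommGroup V] [Module ℂ V] [AddCommGroup W] [Module ℂ W]
    (p : V →ₗ[ℂ] W →ₗ[ℂ] ℂ) : LieSubalgebra ℂ (MackeyGL p) where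
  __ := LinearMap.ker (MackeyGL.tr p)
  lie_mem' {x y} _ _ := by
    change MackeyGL.tr p ⁅x, y⁆ = 0
    rw [MackeyGL.lie_eq, map_sub, sub_eq_zero]
    exact MackeyGL.tr_mul_comm p x y

/-- A Lie subalgebra `H` of a complex Lie algebra `L` is a *local Cartan subalgebra* if `L` is the
direct limit (directed union) of a directed system `(g i)` of finite-dimensional simple Lie
subalgebras, and `H` is the direct limit of Cartan subalgebras `h i` of the `g i`, such that
the embedding of `g i` into `g j` maps `h i` into `h j` for all `i ≤ j`. -/
def IsLocalCartanSubalgebra {L : Type u} [LieRing L] [LieAlgebra ℂ L]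
    (H : LieSubalgebra ℂ L) : Prop :=
  ∃ (I : Type u) (_ : Preorder I) (_ : Nonempty I) (_ : IsDirectedOrder I)
    (g : I → LieSubalgebra ℂ L) (h : ∀ i, LieSubalgebra ℂ (g i)),
    Monotone g ∧
    (∀ i, FiniteDimensional ℂ (g i)) ∧
    (∀ i, LieAlgebra.IsSimple ℂ (g i)) ∧
    (∀ x : L, ∃ i, x ∈ g i) ∧
    (∀ i, (h i).IsCartanSubalgebra) ∧
    Monotone (fun i => (h i).map (g i).incl) ∧
    (∀ x : L, x ∈ H ↔ ∃ i, x ∈ (h i).map (g i).incl)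

/-- For a basis `b` of `V`, the family `w` in `W` consists of the elements that represent, via the
pairing, the functionals dual to `b` (the coordinate functionals), and `W` is their span. -/
def IsSpanningDualFamily {V : Type u} {W : Type v} [AddCommGroup V] [Module ℂ V] [AddCommGroup W]
    [Module ℂ W] (p : V →ₗ[ℂ] W →ₗ[ℂ] ℂ) {ι : Type u} (b : Module.Basis ι ℂ V) (w : ι → W) :
    Prop :=
  (∀ γ, p.flip (w γ) = b.coord γ) ∧ Submodule.span ℂ (Set.range w) = ⊤

end

/-! Consider first a local Cartan subalgebra. Three dual pairs of vectors exist, and from some index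
on every member `g` of the directed system contains the resulting standard `sl 3`. Such a simple `g`
is itself a standard `sl m`, that is, the traceless part of a corner `E gl(V, W) E` with `E = ∑ e i
⊗ f i` for dual systems `e`, `f`. Indeed, the trace form is nondegenerate on `g`, because its
radical is a proper ideal. Start from a standard `sl n` in `g`, `n ≥ 3`. If some element of `g` has
a nonzero component in `E gl (1 - E)` or `(1 - E) gl E`, then pairing it with a second element of
`g` under the trace form produces one more dual pair, and `sl n` grows to `sl (n + 1)` inside `g`;
finite dimension stops this. If all these components vanish, the corner is a nonzero ideal of `g`,
hence all of `g` (`MackeyGL.IsDual.exists_eq_corner`).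

A Cartan subalgebra of `sl m` consists of the traceless diagonal matrices in some basis, by weight
space decomposition (`exists_basis_mem_range_iff`). For `m ≥ 3` each diagonal rank one idempotent is
a product of two traceless diagonal elements, so inclusions of Cartan subalgebras force inclusions
of the sets of idempotents (`MackeyGL.IsDual.exists_diag_eq`). The union of these sets consists of
pairwise orthogonal idempotents `v ⊗ w`; the vectors `v` form the basis and the `w` its dual family
(`MackeyGL.exists_isSpanningDualFamily`).

Conversely, given such a basis, each finite subset with at least two elements spans a standard
simple `sl n`, whose diagonal part is a Cartan subalgebra; these exhaust `sl(V, W)` compatibly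
(`MackeyGL.IsDual.isLocalCartanSubalgebra_diagonal`). -/

noncomputable section

/-! ### The associative algebra `V ⊗ W`, dual systems and corners -/

namespace MackeyGL

variable {V : Type u} {W : Type v} [AddCommGroup V] [Module ℂ V] [AddCommGroup W] [Module ℂ W]
variable {p : V →ₗ[ℂ] W →ₗ[ℂ] ℂ}

/-- `gl(V, W)` as an associative ring, without unit if `V` is infinite-dimensional. -/
abbrev nonUnitalRing : NonUnitalRing (MackeyGL p) where
  mul x y := mul p x y
  left_distrib x y z := map_add (mul p x) y z
  right_distrib x y z := LinearMap.map_add₂ (mul p) x y z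
  zero_mul x := LinearMap.map_zero₂ (mul p) x
  mul_zero x := map_zero (mul p x)
  mul_assoc := mul_assoc' p

attribute [local instance] nonUnitalRing

instance instIsScalarTower : IsScalarTower ℂ (MackeyGL p) (MackeyGL p) where
  smul_assoc c x y := LinearMap.map_smul₂ (mul p) c x y

instance instSMulCommClass : SMulCommClass ℂ (MackeyGL p) (MackeyGL p) where
  smul_comm c x y := (map_smul (mul p x) c y).symm

theorem lie_def (x y : MackeyGL p) : ⁅x, y⁆ = x * y - y * x := rfl

theorem tmul_mul_tmul (v v' : V) (w w' : W) :
    tmul p v w * tmul p v' w' = p v' w • tmul p v w' :=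
  mul_tmul_tmul p v v' w w'

theorem tr_mul_comm_mul (x y : MackeyGL p) : tr p (x * y) = tr p (y * x) := tr_mul_comm p x y

/-- The pure tensor `v ⊗ w`, as a bilinear function of `v` and `w`. -/
def tmulₗ (p : V →ₗ[ℂ] W →ₗ[ℂ] ℂ) : V →ₗ[ℂ] W →ₗ[ℂ] MackeyGL p :=
  TensorProduct.mk ℂ V W

theorem tmulₗ_apply (v : V) (w : W) : tmulₗ p v w = tmul p v w := rfl

theorem tmul_add (v : V) (w w' : W) : tmul p v (w + w') = tmul p v w + tmul p v w' :=
  map_add (tmulₗ p v) w w'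

theorem add_tmul (v v' : V) (w : W) : tmul p (v + v') w = tmul p v w + tmul p v' w :=
  LinearMap.map_add₂ (tmulₗ p) v v' w

theorem smul_tmul (c : ℂ) (v : V) (w : W) : tmul p (c • v) w = c • tmul p v w :=
  LinearMap.map_smul₂ (tmulₗ p) c v w

theorem tmul_smul (c : ℂ) (v : V) (w : W) : tmul p v (c • w) = c • tmul p v w :=
  map_smul (tmulₗ p v) c w

theorem sum_tmul {κ : Type*} (s : Finset κ) (f : κ → V) (w : W) :
    tmul p (∑ k ∈ s, f k) w = ∑ k ∈ s, tmul p (f k) w :=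
  map_sum ((tmulₗ p).flip w) f s

theorem tmul_sum {κ : Type*} (s : Finset κ) (v : V) (f : κ → W) :
    tmul p v (∑ k ∈ s, f k) = ∑ k ∈ s, tmul p v (f k) :=
  map_sum (tmulₗ p v) f s

theorem induction_on {P : MackeyGL p → Prop} (x : MackeyGL p) (zero : P 0)
    (tmul : ∀ v w, P (tmul p v w)) (add : ∀ x y, P x → P y → P (x + y)) : P x :=
  TensorProduct.induction_on (motive := P) x zero tmul add

/-- The natural action of `gl(V, W)` on `V`. -/
def actV (p : V →ₗ[ℂ] W →ₗ[ℂ] ℂ) : MackeyGL p →ₗ[ℂ] V →ₗ[ℂ] V :=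
  (TensorProduct.lift (LinearMap.mk₂ ℂ (fun v w => (p.flip w).smulRight v)
    (fun _ _ _ => by ext; simp) (fun c _ _ => by ext; simp [smul_comm c])
    (fun _ _ _ => by ext; simp [add_smul]) (fun _ _ _ => by ext; simp [mul_smul])) :
    V ⊗[ℂ] W →ₗ[ℂ] V →ₗ[ℂ] V)

/-- The transpose of the natural action of `gl(V, W)` on `V`, acting on `W`. -/
def actW (p : V →ₗ[ℂ] W →ₗ[ℂ] ℂ) : MackeyGL p →ₗ[ℂ] W →ₗ[ℂ] W :=
  (TensorProduct.lift (LinearMap.mk₂ ℂ (fun v w => (p v).smulRight w)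
    (fun _ _ _ => by ext; simp [add_smul]) (fun _ _ _ => by ext; simp [mul_smul])
    (fun _ _ _ => by ext; simp) (fun c _ _ => by ext; simp [smul_comm c])) :
    V ⊗[ℂ] W →ₗ[ℂ] W →ₗ[ℂ] W)

@[simp] theorem actV_tmul (v v' : V) (w : W) : actV p (tmul p v w) v' = p v' w • v :=
  DFunLike.congr_fun (TensorProduct.lift.tmul v w) v'

@[simp] theorem actW_tmul (v : V) (w w' : W) : actW p (tmul p v w) w' = p v w' • w :=
  DFunLike.congr_fun (TensorProduct.lift.tmul v w) w'

theorem mul_tmul (x : MackeyGL p) (v : V) (w : W) : x * tmul p v w = tmul p (actV p x v) w := by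
  induction x using induction_on with
  | zero => simp [← tmulₗ_apply]
  | tmul v' w' => simp [tmul_mul_tmul, smul_tmul]
  | add x y hx hy => simp [add_mul, hx, hy, add_tmul]

theorem tmul_mul (x : MackeyGL p) (v : V) (w : W) : tmul p v w * x = tmul p v (actW p x w) := by
  induction x using induction_on with
  | zero => simp [← tmulₗ_apply]
  | tmul v' w' => simp [tmul_mul_tmul, tmul_smul]
  | add x y hx hy => simp [mul_add, hx, hy, tmul_add]

theorem pairing_act (x : MackeyGL p) (v : V) (w : W) : p (actV p x v) w = p v (actW p x w) := by
  induction x using induction_on with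
  | zero => simp
  | tmul v' w' => simp [mul_comm]
  | add x y hx hy => simp [hx, hy]

theorem actV_mul (x y : MackeyGL p) (v : V) : actV p (x * y) v = actV p x (actV p y v) := by
  induction y using induction_on with
  | zero => simp
  | tmul v' w' => simp [mul_tmul]
  | add y z hy hz => simp [mul_add, hy, hz]

theorem actW_mul (x y : MackeyGL p) (w : W) : actW p (x * y) w = actW p y (actW p x w) := by
  induction x using induction_on with
  | zero => simp
  | tmul v' w' => simp [tmul_mul]
  | add y z hy hz => simp [add_mul, hy, hz]

theorem tr_tmul_mul (x : MackeyGL p) (v : V) (w : W) :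
    tr p (tmul p v w * x) = p (actV p x v) w := by
  rw [tmul_mul, tr_tmul, pairing_act]

/-- Families `e` in `V` and `f` in `W` that are dual to each other. -/
def IsDual (p : V →ₗ[ℂ] W →ₗ[ℂ] ℂ) {ι : Type*} [DecidableEq ι] (e : ι → V) (f : ι → W) : Prop :=
  ∀ i j, p (e i) (f j) = if i = j then 1 else 0

/-- The idempotent `∑ i, e i ⊗ f i` of a finite dual system. -/
def idem (p : V →ₗ[ℂ] W →ₗ[ℂ] ℂ) {ι : Type*} [Fintype ι] (e : ι → V) (f : ι → W) : MackeyGL p :=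
  ∑ i, tmul p (e i) (f i)

theorem actV_idem {ι : Type*} [Fintype ι] (e : ι → V) (f : ι → W) (v : V) :
    actV p (idem p e f) v = ∑ i, p v (f i) • e i := by
  simp [idem]

theorem actW_idem {ι : Type*} [Fintype ι] (e : ι → V) (f : ι → W) (w : W) :
    actW p (idem p e f) w = ∑ i, p (e i) w • f i := by
  simp [idem]

/-- Matrix expansion of a corner element: the number `p (actV p x (e j)) (f i)` plays the role of
the `(i, j)` entry throughout. -/
theorem idem_mul_mul_idem {ι : Type*} [Fintype ι] (x : MackeyGL p) (e : ι → V) (f : ι → W) :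
    idem p e f * x * idem p e f =
      ∑ i, ∑ j, p (actV p x (e j)) (f i) • tmul p (e i) (f j) := by
  rw [idem, Finset.sum_mul, Finset.sum_mul]
  refine Finset.sum_congr rfl fun i _ => ?_
  rw [Finset.mul_sum]
  refine Finset.sum_congr rfl fun j _ => ?_
  rw [tmul_mul, MackeyGL.tmul_mul_tmul, pairing_act]

/-- The trace zero part of the corner `E gl(V, W) E`. -/
def corner (E : MackeyGL p) : Submodule ℂ (MackeyGL p) where
  carrier := {x | E * x = x ∧ x * E = x ∧ tr p x = 0}
  add_mem' {x y} hx hy := by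
    simp only [Set.mem_ofPred_eq] at *
    simp [mul_add, add_mul, hx, hy]
  zero_mem' := by simp
  smul_mem' c x hx := by
    simp only [Set.mem_ofPred_eq] at *
    simp [mul_smul_comm, smul_mul_assoc, hx]

theorem mem_corner {E x : MackeyGL p} : x ∈ corner E ↔ E * x = x ∧ x * E = x ∧ tr p x = 0 :=
  Iff.rfl

theorem lie_mem_corner {E x y : MackeyGL p} (hx : x ∈ corner E) (hy : y ∈ corner E) :
    ⁅x, y⁆ ∈ corner E := by
  rw [mem_corner] at *
  refine ⟨?_, ?_, ?_⟩
  · rw [lie_def, mul_sub, ← mul_assoc, ← mul_assoc, hx.1, hy.1]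
  · rw [lie_def, sub_mul, mul_assoc, mul_assoc, hx.2.1, hy.2.1]
  · rw [lie_def, map_sub, tr_mul_comm_mul, sub_self]

namespace IsDual

variable {ι : Type*} [DecidableEq ι] {e : ι → V} {f : ι → W}

theorem tmul_mul_tmul (h : IsDual p e f) (i j k l : ι) :
    tmul p (e i) (f j) * tmul p (e k) (f l) = if k = j then tmul p (e i) (f l) else 0 := by
  rw [MackeyGL.tmul_mul_tmul, h]
  split_ifs <;> simp

theorem tr_tmul (h : IsDual p e f) (i j : ι) :
    tr p (tmul p (e i) (f j)) = if i = j then 1 else 0 := by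
  rw [MackeyGL.tr_tmul, h]

variable [Fintype ι]

theorem idem_mul_tmul (h : IsDual p e f) (i : ι) (w : W) :
    idem p e f * tmul p (e i) w = tmul p (e i) w := by
  rw [mul_tmul, actV_idem]; simp [h i]

theorem tmul_mul_idem (h : IsDual p e f) (i : ι) (v : V) :
    tmul p v (f i) * idem p e f = tmul p v (f i) := by
  rw [tmul_mul, actW_idem]
  simp [fun j => h j i]

theorem idem_mul_idem (h : IsDual p e f) : idem p e f * idem p e f = idem p e f := by
  conv_lhs => rhs; rw [idem]
  rw [Finset.mul_sum]
  simp_rw [h.idem_mul_tmul]; rfl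

theorem tr_idem (h : IsDual p e f) : tr p (idem p e f) = Fintype.card ι := by
  simp [idem, MackeyGL.tr_tmul, h _ _]

theorem tmul_mem_corner (h : IsDual p e f) {i j : ι} (hij : i ≠ j) :
    tmul p (e i) (f j) ∈ corner (idem p e f) :=
  ⟨h.idem_mul_tmul _ _, h.tmul_mul_idem _ _, by simp [h.tr_tmul, hij]⟩

/-- The corner is the span of the matrix units off the diagonal and the differences of the
matrix units on the diagonal. -/
theorem corner_le (h : IsDual p e f) {g : Submodule ℂ (MackeyGL p)}
    (hu : ∀ i j, i ≠ j → tmul p (e i) (f j) ∈ g)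
    (hd : ∀ i j, tmul p (e i) (f i) - tmul p (e j) (f j) ∈ g) : corner (idem p e f) ≤ g := by
  rintro x ⟨h1, h2, h3⟩
  have hx : x = ∑ i, ∑ j, p (actV p x (e j)) (f i) • tmul p (e i) (f j) := by
    rw [← idem_mul_mul_idem, h1, h2]
  rcases isEmpty_or_nonempty ι with hι | ⟨⟨o⟩⟩
  · rw [hx]; simp
  have ht : ∑ i, p (actV p x (e i)) (f i) = 0 := by
    rw [← h3]; conv_rhs => rw [hx]
    simp [h.tr_tmul]
  -- Subtracting the fixed unit `e o ⊗ f o` from every diagonal unit changes nothing, since the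
  -- diagonal coefficients sum to the trace, which is zero.
  have : x = ∑ i, ∑ j, p (actV p x (e j)) (f i) •
      (tmul p (e i) (f j) - if i = j then tmul p (e o) (f o) else 0) := by
    conv_lhs => rw [hx]
    simp only [smul_sub, Finset.sum_sub_distrib, smul_ite, smul_zero, Finset.sum_ite_eq,
      Finset.mem_univ, if_true]
    rw [← Finset.sum_smul, ht]; simp
  rw [this]
  refine Submodule.sum_mem _ fun i _ => Submodule.sum_mem _ fun j _ => Submodule.smul_mem _ _ ?_
  split_ifs with hij
  · subst hij; exact hd i o
  · simpa using hu i j hij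

theorem corner_le_lieSubalgebra (h : IsDual p e f) {g : LieSubalgebra ℂ (MackeyGL p)}
    (hu : ∀ i j, i ≠ j → tmul p (e i) (f j) ∈ g) : corner (idem p e f) ≤ g.toSubmodule := by
  refine h.corner_le hu fun i j => ?_
  by_cases hij : i = j
  · subst hij; simp
  have := g.lie_mem (hu i j hij) (hu j i (Ne.symm hij))
  simpa [lie_def, h.tmul_mul_tmul] using this

end IsDual

/-! ### Simple subalgebras containing `sl 3` are corners -/

/-- A Lie subalgebra all of whose ideals are trivial. -/
def HasTrivialIdeals (g : LieSubalgebra ℂ (MackeyGL p)) : Prop :=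
  ∀ J : Submodule ℂ (MackeyGL p), J ≤ g.toSubmodule → (∀ x ∈ g, ∀ y ∈ J, ⁅x, y⁆ ∈ J) →
    J = ⊥ ∨ g.toSubmodule ≤ J

/-- By invariance of the trace form its radical in `g` is an ideal, and the pair `x₀`, `y₀` shows
that it is not all of `g`; hence it is zero. -/
theorem HasTrivialIdeals.exists_tr_mul_ne_zero {g : LieSubalgebra ℂ (MackeyGL p)}
    (hg : HasTrivialIdeals g) {x₀ y₀ : MackeyGL p} (hx₀ : x₀ ∈ g) (hy₀ : y₀ ∈ g)
    (h₀ : tr p (x₀ * y₀) ≠ 0) {x : MackeyGL p} (hx : x ∈ g) (hx0 : x ≠ 0) :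
    ∃ y ∈ g, tr p (x * y) ≠ 0 := by
  by_contra! hc
  let J : Submodule ℂ (MackeyGL p) :=
    { carrier := {z | z ∈ g ∧ ∀ y ∈ g, tr p (z * y) = 0}
      add_mem' := fun {a b} ha hb =>
        ⟨add_mem ha.1 hb.1, fun y hy => by rw [add_mul, map_add, ha.2 y hy, hb.2 y hy, add_zero]⟩
      zero_mem' := ⟨zero_mem g, fun y _ => by simp⟩
      smul_mem' := fun c a ha =>
        ⟨g.smul_mem c ha.1, fun y hy => by rw [smul_mul_assoc, map_smul, ha.2 y hy, smul_zero]⟩ }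
  have hJ : ∀ a ∈ g, ∀ b ∈ J, ⁅a, b⁆ ∈ J := fun a ha b hb => ⟨g.lie_mem ha hb.1, fun y hy => by
    have := hb.2 _ (g.lie_mem ha hy)
    rw [lie_def, mul_sub, map_sub, sub_eq_zero] at this
    rw [lie_def, sub_mul, map_sub, sub_eq_zero, mul_assoc, mul_assoc, this, tr_mul_comm_mul,
      mul_assoc]⟩
  rcases hg J (fun z hz => hz.1) hJ with h | h
  · have : x ∈ J := ⟨hx, hc⟩
    rw [h] at this
    exact hx0 (by simpa using this)
  · exact h₀ ((h hx₀).2 y₀ hy₀)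

namespace IsDual

section Peirce

variable {ι : Type*} [DecidableEq ι] [Fintype ι] {e : ι → V} {f : ι → W}

/-- Correction term for the two lemmas below. A double bracket of `x` with the units `(a, b)` and
`(b, c)` gives the wanted product except for terms in the corner; `y` is chosen to make their total
trace vanish, so that they lie in `g`. -/
theorem aux_mem_corner (h : IsDual p e f) {a b c : ι} (hac : a ≠ c) (x y : MackeyGL p)
    (hy : idem p e f * y = y ∧ y * idem p e f = y)
    (hxy : tr p y = tr p (x * tmul p (e a) (f c))) :
    tmul p (e a) (f b) * x * tmul p (e b) (f c) + tmul p (e b) (f c) * x * tmul p (e a) (f b) - y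
      ∈ corner (idem p e f) := by
  refine ⟨?_, ?_, ?_⟩
  · simp only [mul_sub, mul_add, ← mul_assoc, h.idem_mul_tmul, hy.1]
  · simp only [sub_mul, add_mul, mul_assoc, h.tmul_mul_idem, hy.2]
  · rw [map_sub, map_add, mul_assoc, tr_mul_comm_mul, mul_assoc, h.tmul_mul_tmul,
      if_neg hac, mul_zero, mul_assoc, tr_mul_comm_mul (tmul p (e b) (f c)), mul_assoc,
      h.tmul_mul_tmul, if_pos rfl, hxy]
    simp

/-- Writing `u a c` for the units, `[u a b, [u b c, x]] = u a c * x - u a b * x * u b c - u b c * x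
* u a b` when `a`, `b`, `c` are distinct, and the last two terms are traded for `u a c * x * E`
modulo the corner. The third index `b` is why `3 ≤ card ι` is needed. The case `a = c` follows by
one more bracket. -/
theorem tmul_mul_sub_mem (h : IsDual p e f) (hι : 3 ≤ Fintype.card ι)
    {g : LieSubalgebra ℂ (MackeyGL p)} (hu : ∀ i j, i ≠ j → tmul p (e i) (f j) ∈ g)
    {x : MackeyGL p} (hx : x ∈ g) (a c : ι) :
    tmul p (e a) (f c) * (x - x * idem p e f) ∈ g := by
  have key : ∀ a c, a ≠ c → tmul p (e a) (f c) * (x - x * idem p e f) ∈ g := by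
    intro a c hac
    obtain ⟨b, hb⟩ : ∃ b, b ∉ ({a, c} : Finset ι) := by
      by_contra! hb
      have := Finset.card_le_card (fun b _ => hb b : Finset.univ ⊆ ({a, c} : Finset ι))
      have := this.trans Finset.card_le_two
      simp only [Finset.card_univ] at this
      omega
    simp only [Finset.mem_insert, Finset.mem_singleton, not_or] at hb
    have h1 := g.lie_mem (hu a b (Ne.symm hb.1)) (g.lie_mem (hu b c hb.2) hx)
    have h2 := h.corner_le_lieSubalgebra hu (h.aux_mem_corner (b := b) hac x
      (tmul p (e a) (f c) * x * idem p e f)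
      ⟨by rw [← mul_assoc, ← mul_assoc, h.idem_mul_tmul],
        by rw [mul_assoc, h.idem_mul_idem]⟩
      (by rw [tr_mul_comm_mul, ← mul_assoc, h.idem_mul_tmul, tr_mul_comm_mul]))
    convert add_mem h1 h2 using 1
    have e1 : tmul p (e a) (f b) * (tmul p (e b) (f c) * x) = tmul p (e a) (f c) * x := by
      rw [← mul_assoc, h.tmul_mul_tmul, if_pos rfl]
    have e2 : tmul p (e b) (f c) * tmul p (e a) (f b) = 0 := by
      rw [h.tmul_mul_tmul, if_neg hac]
    simp only [lie_def, mul_sub, sub_mul, mul_assoc, e1, e2, mul_zero]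
    abel
  by_cases hac : a = c
  · subst hac
    obtain ⟨b, hb⟩ : ∃ b, b ≠ a :=
      haveI := Fintype.one_lt_card_iff_nontrivial.mp (by omega : 1 < Fintype.card ι)
      exists_ne a
    convert g.lie_mem (hu a b hb.symm) (key b a hb) using 1
    have e1 : (x - x * idem p e f) * tmul p (e a) (f b) = 0 := by
      rw [sub_mul, mul_assoc, h.idem_mul_tmul, sub_self]
    rw [lie_def, mul_assoc _ _ (tmul p (e a) (f b)), e1, mul_zero, sub_zero, ← mul_assoc,
      h.tmul_mul_tmul, if_pos rfl]
  · exact key a c hac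

/-- Mirror image of `tmul_mul_sub_mem`, using `[[x, u a b], u b c]`. -/
theorem sub_mul_tmul_mem (h : IsDual p e f) (hι : 3 ≤ Fintype.card ι)
    {g : LieSubalgebra ℂ (MackeyGL p)} (hu : ∀ i j, i ≠ j → tmul p (e i) (f j) ∈ g)
    {x : MackeyGL p} (hx : x ∈ g) (a c : ι) :
    (x - idem p e f * x) * tmul p (e a) (f c) ∈ g := by
  have key : ∀ a c, a ≠ c → (x - idem p e f * x) * tmul p (e a) (f c) ∈ g := by
    intro a c hac
    obtain ⟨b, hb⟩ : ∃ b, b ∉ ({a, c} : Finset ι) := by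
      by_contra! hb
      have := Finset.card_le_card (fun b _ => hb b : Finset.univ ⊆ ({a, c} : Finset ι))
      have := this.trans Finset.card_le_two
      simp only [Finset.card_univ] at this
      omega
    simp only [Finset.mem_insert, Finset.mem_singleton, not_or] at hb
    have h1 := g.lie_mem (g.lie_mem hx (hu a b (Ne.symm hb.1))) (hu b c hb.2)
    have h2 := h.corner_le_lieSubalgebra hu (h.aux_mem_corner (b := b) hac x
      (idem p e f * x * tmul p (e a) (f c))
      ⟨by rw [← mul_assoc, ← mul_assoc, h.idem_mul_idem],
        by rw [mul_assoc, h.tmul_mul_idem]⟩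
      (by rw [mul_assoc, tr_mul_comm_mul, mul_assoc, h.tmul_mul_idem]))
    convert add_mem h1 h2 using 1
    have e1 : tmul p (e a) (f b) * tmul p (e b) (f c) = tmul p (e a) (f c) := by
      rw [h.tmul_mul_tmul, if_pos rfl]
    have e2 : tmul p (e b) (f c) * (tmul p (e a) (f b) * x) = 0 := by
      rw [← mul_assoc, h.tmul_mul_tmul, if_neg hac, zero_mul]
    simp only [lie_def, mul_sub, sub_mul, mul_assoc, e1, e2]
    abel
  by_cases hac : a = c
  · subst hac
    obtain ⟨b, hb⟩ : ∃ b, b ≠ a :=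
      haveI := Fintype.one_lt_card_iff_nontrivial.mp (by omega : 1 < Fintype.card ι)
      exists_ne a
    convert g.lie_mem (key a b hb.symm) (hu b a hb) using 1
    have e1 : tmul p (e b) (f a) * ((x - idem p e f * x) * tmul p (e a) (f b)) = 0 := by
      rw [← mul_assoc, mul_sub, ← mul_assoc, h.tmul_mul_idem, sub_self, zero_mul]
    rw [lie_def, e1, sub_zero, mul_assoc, h.tmul_mul_tmul, if_pos rfl]
  · exact key a c hac

end Peirce

theorem cons {n : ℕ} {e : Fin n → V} {f : Fin n → W} (h : IsDual p e f) {v : V} {w : W}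
    (hvw : p v w = 1) (hv : ∀ i, p v (f i) = 0) (hw : ∀ i, p (e i) w = 0) :
    IsDual p (Fin.cons v e : Fin (n + 1) → V) (Fin.cons w f : Fin (n + 1) → W) := by
  intro i j
  induction i using Fin.cases <;> induction j using Fin.cases <;>
    simp [hvw, hv, hw, h _ _, Fin.succ_ne_zero, (Fin.succ_ne_zero _).symm]

/-- The new pair is `v = (1 - E) y (e a)`, rescaled, and `w`, the image of `f a` under the transpose
of `x (1 - E)`. Both are orthogonal to the old system by the factor `1 - E`, and the Peirce lemmas
put `e i ⊗ w` and `v ⊗ f j` in `g`. The diagonal tensor `v ⊗ w` is not needed. -/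
theorem exists_extension {n : ℕ} {e : Fin n → V} {f : Fin n → W} (h : IsDual p e f) (hn : 3 ≤ n)
    {g : LieSubalgebra ℂ (MackeyGL p)} (hu : ∀ i j, i ≠ j → tmul p (e i) (f j) ∈ g)
    {x y : MackeyGL p} (hx : x ∈ g) (hy : y ∈ g) (a : Fin n)
    (hxy : p (actV p (y - idem p e f * y) (e a)) (actW p (x - x * idem p e f) (f a)) ≠ 0) :
    ∃ (e' : Fin (n + 1) → V) (f' : Fin (n + 1) → W), IsDual p e' f' ∧
      ∀ i j, i ≠ j → tmul p (e' i) (f' j) ∈ g := by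
  set v := actV p (y - idem p e f * y) (e a)
  set w := actW p (x - x * idem p e f) (f a)
  have hE : ∀ b, actV p (idem p e f) (e b) = e b := fun b => by simp [actV_idem, h b]
  have hF : ∀ b, actW p (idem p e f) (f b) = f b := fun b => by
    simp [actW_idem, fun i => h i b]
  refine ⟨Fin.cons ((p v w)⁻¹ • v) e, Fin.cons w f, h.cons ?_ (fun i => ?_) (fun i => ?_), ?_⟩
  · simp [inv_mul_cancel₀ hxy]
  · have : p v (f i) = 0 := by
      simp only [v]
      rw [pairing_act, map_sub, LinearMap.sub_apply, actW_mul, hF, sub_self, map_zero]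
    simp [this]
  · simp only [w]
    rw [← pairing_act, map_sub, LinearMap.sub_apply, actV_mul, hE, sub_self, map_zero,
      LinearMap.zero_apply]
  · have h1 : ∀ i, tmul p (e i) w ∈ g := fun i => by
      simpa only [tmul_mul] using h.tmul_mul_sub_mem (by simpa using hn) hu hx i a
    have h2 : ∀ i, tmul p v (f i) ∈ g := fun i => by
      simpa only [mul_tmul] using h.sub_mul_tmul_mem (by simpa using hn) hu hy a i
    intro i j hij
    induction i using Fin.cases with
    | zero =>
      induction j using Fin.cases with
      | zero => exact absurd rfl hij
      | succ j => simpa [smul_tmul] using g.smul_mem _ (h2 j)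
    | succ i =>
      induction j using Fin.cases with
      | zero => simpa using h1 i
      | succ j => simpa using hu i j fun hh => hij (by rw [hh])

/-- If no element of `g` has a component in `E gl (1 - E)` or `(1 - E) gl E`, then `E` commutes with
`g` and the corner is a nonzero ideal. Otherwise such a component is a nonzero element of `g` after
multiplication by a unit, and nondegeneracy of the trace form supplies the second element required
for an extension. -/
theorem eq_corner_or_exists_extension {n : ℕ} {e : Fin n → V} {f : Fin n → W} (h : IsDual p e f)
    (hn : 3 ≤ n) {g : LieSubalgebra ℂ (MackeyGL p)} (hg : HasTrivialIdeals g)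
    (hu : ∀ i j, i ≠ j → tmul p (e i) (f j) ∈ g) :
    g.toSubmodule = corner (idem p e f) ∨
    ∃ (e' : Fin (n + 1) → V) (f' : Fin (n + 1) → W), IsDual p e' f' ∧
      ∀ i j, i ≠ j → tmul p (e' i) (f' j) ∈ g := by
  have h01 : (⟨0, by omega⟩ : Fin n) ≠ ⟨1, by omega⟩ := by simp
  have htr : tr p (tmul p (e ⟨0, by omega⟩) (f ⟨1, by omega⟩) *
      tmul p (e ⟨1, by omega⟩) (f ⟨0, by omega⟩)) ≠ 0 := by
    simp [h.tmul_mul_tmul, h.tr_tmul]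
  have nondeg := fun {x} => hg.exists_tr_mul_ne_zero (hu _ _ h01) (hu _ _ h01.symm) htr (x := x)
  by_cases h1 : ∀ x ∈ g, ∀ a, tmul p (e a) (f a) * (x - x * idem p e f) = 0
  · by_cases h2 : ∀ x ∈ g, ∀ a, (x - idem p e f * x) * tmul p (e a) (f a) = 0
    · left
      have comm : ∀ x ∈ g, idem p e f * x = x * idem p e f := by
        intro x hx
        have e1 : idem p e f * (x - x * idem p e f) = 0 := by
          conv_lhs => lhs; rw [idem]
          rw [Finset.sum_mul]
          exact Finset.sum_eq_zero fun a _ => h1 x hx a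
        have e2 : (x - idem p e f * x) * idem p e f = 0 := by
          conv_lhs => rhs; rw [idem]
          rw [Finset.mul_sum]
          exact Finset.sum_eq_zero fun a _ => h2 x hx a
        rw [mul_sub, sub_eq_zero] at e1
        rw [sub_mul, sub_eq_zero, mul_assoc] at e2
        exact e1.trans e2.symm
      have hle := h.corner_le_lieSubalgebra hu
      refine le_antisymm ((hg _ hle fun x hx y hy => ?_).resolve_left fun hb => ?_) hle
      · refine ⟨?_, ?_, by rw [lie_def, map_sub, tr_mul_comm_mul, sub_self]⟩
        · rw [lie_def, mul_sub, ← mul_assoc, ← mul_assoc, comm x hx, mul_assoc, hy.1]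
        · rw [lie_def, sub_mul, mul_assoc, mul_assoc, ← comm x hx, hy.2.1, ← mul_assoc y, hy.2.1]
      · have := h.tmul_mem_corner h01
        rw [hb, Submodule.mem_bot] at this
        rw [this, zero_mul, map_zero] at htr
        exact htr rfl
    · right
      push Not at h2
      obtain ⟨y, hy, a, ha⟩ := h2
      obtain ⟨x, hx, hxy⟩ := nondeg (h.sub_mul_tmul_mem (by simpa using hn) hu hy a a) ha
      refine h.exists_extension hn hu hx hy a ?_
      rw [mul_tmul, tr_tmul_mul, pairing_act] at hxy
      rw [map_sub (actW p), LinearMap.sub_apply, map_sub, actW_mul, ← pairing_act (idem p e f),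
        ← actV_mul, mul_sub, ← mul_assoc, h.idem_mul_idem, sub_self]
      simpa using hxy
  · right
    push Not at h1
    obtain ⟨x, hx, a, ha⟩ := h1
    obtain ⟨y, hy, hxy⟩ := nondeg (h.tmul_mul_sub_mem (by simpa using hn) hu hx a a) ha
    refine h.exists_extension hn hu hx hy a ?_
    rw [tmul_mul, tr_tmul_mul] at hxy
    rw [map_sub (actV p) y, LinearMap.sub_apply, map_sub, actV_mul, LinearMap.sub_apply,
      pairing_act (idem p e f), ← actW_mul, sub_mul, mul_assoc, h.idem_mul_idem, sub_self]
    simpa using hxy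

/-- A finite-dimensional Lie subalgebra of `gl(V, W)` without nontrivial ideals that contains a
standard `sl n` with `n ≥ 3` is itself a standard `sl m`. -/
theorem exists_eq_corner {n : ℕ} {e : Fin n → V} {f : Fin n → W} (h : IsDual p e f)
    (hn : 3 ≤ n) {g : LieSubalgebra ℂ (MackeyGL p)} (hg : HasTrivialIdeals g)
    [FiniteDimensional ℂ g] (hu : ∀ i j, i ≠ j → tmul p (e i) (f j) ∈ g) :
    ∃ (m : ℕ) (e' : Fin m → V) (f' : Fin m → W), 3 ≤ m ∧ IsDual p e' f' ∧
      g.toSubmodule = corner (idem p e' f') := by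
  by_contra! hc
  have key : ∀ m : ℕ, n ≤ m → ∃ (e' : Fin m → V) (f' : Fin m → W), IsDual p e' f' ∧
      ∀ i j, i ≠ j → tmul p (e' i) (f' j) ∈ g := by
    intro m hm
    induction m, hm using Nat.le_induction with
    | base => exact ⟨e, f, h, hu⟩
    | succ m hm ih =>
      obtain ⟨e', f', h', hu'⟩ := ih
      exact (h'.eq_corner_or_exists_extension (hn.trans hm) hg hu').resolve_left
        (hc m e' f' (hn.trans hm) h')
  -- Index `0` serves as the common column; the remaining `n + finrank` rows give that many
  -- independent units in `g`, too many since `n ≥ 3`.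
  obtain ⟨e', f', h', hu'⟩ := key (n + Module.finrank ℂ g + 1) (by omega)
  have hli : LinearIndependent ℂ fun i : Fin (n + Module.finrank ℂ g) =>
      (⟨tmul p (e' i.succ) (f' 0), hu' _ _ (Fin.succ_ne_zero i)⟩ : g) := by
    rw [Fintype.linearIndependent_iff]
    intro c hc i
    have h1 : ∑ j, c j • tmul p (e' j.succ) (f' 0) = 0 := by
      simpa using congrArg (Subtype.val) hc
    have h2 := congrArg (fun z => tr p (tmul p (e' 0) (f' i.succ) * z)) h1
    simpa [Finset.mul_sum, mul_smul_comm, h'.tmul_mul_tmul, h'.tr_tmul, apply_ite] using h2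
  have := hli.fintype_card_le_finrank
  simp at this
  omega

end IsDual

end MackeyGL

/-! ### Cartan subalgebras of `sl A` are diagonal -/

section LinearAlgebra

attribute [local instance] LieRing.ofAssociativeRing

theorem Module.End.sub_pow_two_mul_apply_eq_zero {M : Type*} [AddCommGroup M] [Module ℂ M]
    {X Y : Module.End ℂ M} (hXY : Commute X Y) {N : ℕ} {m : M} (hX : (X ^ N) m = 0)
    (hY : (Y ^ N) m = 0) : ((X - Y) ^ (2 * N)) m = 0 := by
  have hY' : ((-Y) ^ N) m = 0 := by rw [neg_pow]; simp [hY]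
  have hc : Commute X (-Y) := hXY.neg_right
  rw [sub_eq_add_neg, hc.add_pow', LinearMap.sum_apply]
  refine Finset.sum_eq_zero fun ij hij => ?_
  rw [Finset.HasAntidiagonal.mem_antidiagonal] at hij
  rw [LinearMap.smul_apply]
  rcases le_total N ij.1 with h | h
  · obtain ⟨d, hd⟩ := Nat.exists_eq_add_of_le' h
    rw [(hc.pow_pow _ _).eq, hd, pow_add, ← mul_assoc, Module.End.mul_apply, hX, map_zero,
      smul_zero]
  · obtain ⟨d, hd⟩ := Nat.exists_eq_add_of_le' (by omega : N ≤ ij.2)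
    rw [hd, pow_add, ← mul_assoc, Module.End.mul_apply, hY', map_zero, smul_zero]

variable {A : Type*} [AddCommGroup A] [Module ℂ A]
variable {𝔥 : Type*} [LieRing 𝔥] [LieAlgebra ℂ 𝔥]

/-- The matrix unit of a basis `b` that takes `b l` to `b k` and the other basis vectors to zero. -/
def Module.Basis.unit {κ : Type*} (b : Module.Basis κ ℂ A) (k l : κ) : Module.End ℂ A :=
  (b.coord l).smulRight (b k)

theorem Module.Basis.unit_apply {κ : Type*} (b : Module.Basis κ ℂ A) (k l : κ) (a : A) :
    b.unit k l a = b.repr a l • b k := rfl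

/-- The two units generate an `sl 2`: the first is an eigenvector of the adjoint action of their
bracket with eigenvalue `2`, whereas that action is nilpotent on `𝔥`. -/
theorem Module.Basis.not_units_mem_range {κ : Type*} (b : Module.Basis κ ℂ A)
    [LieRing.IsNilpotent 𝔥] (φ : 𝔥 →ₗ⁅ℂ⁆ Module.End ℂ A) {k l : κ} (hkl : k ≠ l)
    (h₁ : b.unit k l ∈ φ.range) (h₂ : b.unit l k ∈ φ.range) : False := by
  obtain ⟨z₁, hz₁⟩ := h₁
  obtain ⟨z₂, hz₂⟩ := h₂
  obtain ⟨m, hm⟩ := LieModule.exists_forall_pow_toEnd_eq_zero ℂ 𝔥 𝔥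
  have hz₁' : φ z₁ = b.unit k l := hz₁
  have hz₂' : φ z₂ = b.unit l k := hz₂
  have hb : ⁅⁅b.unit k l, b.unit l k⁆, b.unit k l⁆ = (2 : ℂ) • b.unit k l := by
    refine LinearMap.ext fun a => ?_
    simp only [LieRing.of_associative_ring_bracket, LinearMap.sub_apply, Module.End.mul_apply,
      unit_apply, map_smul, LinearMap.smul_apply]
    simp [hkl.symm, two_smul]
  have key : ∀ n : ℕ, φ ((LieModule.toEnd ℂ 𝔥 𝔥 ⁅z₁, z₂⁆ ^ n) z₁) = (2 : ℂ) ^ n • b.unit k l := by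
    intro n
    induction n with
    | zero => simpa using hz₁
    | succ n ih =>
      rw [pow_succ', Module.End.mul_apply, LieModule.toEnd_apply_apply, LieHom.map_lie, ih,
        LieHom.map_lie, hz₁', hz₂', lie_smul, hb, smul_smul, pow_succ]
  have := key m
  rw [hm, LinearMap.zero_apply, map_zero] at this
  have h3 := congrArg (fun x => b.repr (x (b l)) k) this
  simp only [unit_apply, LinearMap.smul_apply] at h3
  simp at h3
  exact pow_ne_zero m two_ne_zero h3.symm

/-- A nilpotent Lie algebra of traceless endomorphisms that contains its zero root space in
`sl A` is the algebra of traceless endomorphisms that are diagonal in some basis. -/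
theorem exists_basis_mem_range_iff [FiniteDimensional ℂ A] [LieRing.IsNilpotent 𝔥]
    (φ : 𝔥 →ₗ⁅ℂ⁆ Module.End ℂ A) (h₁ : ∀ z, LinearMap.trace ℂ A (φ z) = 0)
    (h₂ : ∀ x, LinearMap.trace ℂ A x = 0 →
      (∀ z, ∃ N : ℕ, (LieAlgebra.ad ℂ (Module.End ℂ A) (φ z) ^ N) x = 0) → x ∈ φ.range) :
    ∃ (n : ℕ) (b : Module.Basis (Fin n) ℂ A), ∀ x, x ∈ φ.range ↔
      LinearMap.trace ℂ A x = 0 ∧ ∀ k l, k ≠ l → b.repr (x (b k)) l = 0 := by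
  classical
  suffices h : ∃ (κ : Type _) (_ : Fintype κ) (b : Module.Basis κ ℂ A), ∀ x, x ∈ φ.range ↔
      LinearMap.trace ℂ A x = 0 ∧ ∀ k l, k ≠ l → b.repr (x (b k)) l = 0 by
    obtain ⟨κ, _, b, hb⟩ := h
    refine ⟨_, b.reindex (Fintype.equivFin κ), fun x => (hb x).trans (and_congr_right fun _ => ?_)⟩
    constructor
    · intro h k l hkl
      simpa using h _ _ ((Fintype.equivFin κ).symm.injective.ne hkl)
    · intro h k l hkl
      simpa using h _ _ ((Fintype.equivFin κ).injective.ne hkl)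
  let : LieRingModule 𝔥 A := LieRingModule.compLieHom A φ
  let : LieModule ℂ 𝔥 A := LieModule.compLieHom A φ
  let S : LieModule.Weight ℂ 𝔥 A → Submodule ℂ A := fun χ =>
    (LieModule.genWeightSpace A χ).toSubmodule
  have hS : DirectSum.IsInternal S := by
    refine DirectSum.isInternal_submodule_of_iSupIndep_of_iSup_eq_top ?_ ?_
    · exact LieSubmodule.iSupIndep_toSubmodule.mpr (LieModule.iSupIndep_genWeightSpace' ℂ 𝔥 A)
    · have := LieModule.iSup_genWeightSpace_eq_top' ℂ 𝔥 A
      rw [← LieSubmodule.toSubmodule_inj, LieSubmodule.iSup_toSubmodule,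
        LieSubmodule.top_toSubmodule] at this
      exact this
  let b := hS.collectedBasis fun χ => Module.finBasis ℂ (S χ)
  have hbS : ∀ k, b k ∈ S k.1 := hS.collectedBasis_mem _
  have hmaps : ∀ z χ a, a ∈ S χ → φ z a ∈ S χ := fun z χ a ha =>
    (LieModule.genWeightSpace A χ).lie_mem (x := z) ha
  have hcoord : ∀ k χ, k.1 ≠ χ → ∀ a ∈ S χ, b.repr a k = 0 := fun k χ hk a ha =>
    hS.collectedBasis_repr_of_mem_ne _ (Ne.symm hk) ha
  have hpow : ∀ z (χ : LieModule.Weight ℂ 𝔥 A), ∀ a ∈ S χ,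
      ((φ z - χ z • (1 : Module.End ℂ A)) ^ Module.finrank ℂ A) a = 0 := by
    intro z χ a ha
    have := LieModule.genWeightSpace_le_genWeightSpaceOf A z χ ha
    have h3 : a ∈ (φ z).maxGenEigenspace (χ z) := this
    rw [Module.End.maxGenEigenspace_eq_genEigenspace_finrank, Module.End.mem_genEigenspace_nat]
      at h3
    exact h3
  -- Left and right multiplication by `φ z - χ z` commute, and a power of each kills a unit inside
  -- the `χ` weight space; so `ad (φ z)`, their difference, is nilpotent on it and `h₂` applies.
  have hunit : ∀ k l, k.1 = l.1 → k ≠ l → b.unit k l ∈ φ.range := by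
    intro k l hkl hne
    refine h₂ _ ?_ fun z => ⟨2 * Module.finrank ℂ A, ?_⟩
    · rw [Module.Basis.unit, LinearMap.trace_smulRight]
      simp [hne]
    · have had : LieAlgebra.ad ℂ (Module.End ℂ A) (φ z) =
          LinearMap.mulLeft ℂ (φ z - l.1 z • (1 : Module.End ℂ A)) -
          LinearMap.mulRight ℂ (φ z - l.1 z • (1 : Module.End ℂ A)) := by
        refine LinearMap.ext fun x => ?_
        simp [LieRing.of_associative_ring_bracket, sub_mul, mul_sub]
      rw [had]
      refine Module.End.sub_pow_two_mul_apply_eq_zero (LinearMap.commute_mulLeft_right _ _) ?_ ?_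
      · rw [LinearMap.pow_mulLeft, LinearMap.mulLeft_apply]
        refine LinearMap.ext fun a => ?_
        rw [Module.End.mul_apply, Module.Basis.unit_apply, map_smul, ← hkl, hpow z _ _ (hbS k),
          smul_zero, LinearMap.zero_apply]
      · rw [LinearMap.pow_mulRight, LinearMap.mulRight_apply]
        refine b.ext fun m => ?_
        rw [Module.End.mul_apply, Module.Basis.unit_apply, LinearMap.zero_apply]
        by_cases hm : l.1 = m.1
        · rw [hm, hpow z _ _ (hbS m)]; simp
        · have : ((φ z - l.1 z • (1 : Module.End ℂ A)) ^ Module.finrank ℂ A) (b m) ∈ S m.1 := by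
            refine Module.End.pow_apply_mem_of_forall_mem _ (fun a ha => ?_) _ (hbS m)
            simpa using sub_mem (hmaps z _ a ha) ((S m.1).smul_mem (l.1 z) ha)
          rw [hcoord l _ hm _ this, zero_smul]
  have hdiag : ∀ {x : Module.End ℂ A}, (∀ k l, k ≠ l → b.repr (x (b k)) l = 0) → ∀ k,
      x (b k) = b.repr (x (b k)) k • b k := by
    intro x hx k
    refine b.ext_elem fun l => ?_
    by_cases hkl : k = l
    · subst hkl; simp
    · simp [hx k l hkl, Ne.symm hkl]
  -- Two basis vectors of equal weight would put both opposite units in the nilpotent image. Hence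
  -- weight spaces are lines, and `φ z` is diagonal.
  have hrange : ∀ z k l, k ≠ l → b.repr (φ z (b k)) l = 0 := by
    intro z k l hkl
    by_cases h : k.1 = l.1
    · exact (b.not_units_mem_range φ hkl (hunit k l h hkl) (hunit l k h.symm hkl.symm)).elim
    · exact hcoord l _ (Ne.symm h) _ (hmaps z _ _ (hbS k))
  refine ⟨_, inferInstance, b, fun x => ⟨?_, fun hx => h₂ x hx.1 fun z => ⟨1, ?_⟩⟩⟩
  · rintro ⟨z, rfl⟩
    exact ⟨h₁ z, hrange z⟩
  · rw [pow_one, LieAlgebra.ad_apply, LieRing.of_associative_ring_bracket, sub_eq_zero]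
    refine b.ext fun k => ?_
    rw [Module.End.mul_apply, Module.End.mul_apply, hdiag hx.2 k, hdiag (hrange z) k, map_smul,
      map_smul, hdiag hx.2 k, hdiag (hrange z) k]
    simp [smul_smul, mul_comm]

end LinearAlgebra

/-! ### Identifying corners with matrix algebras -/

namespace MackeyGL

variable {V : Type u} {W : Type v} [AddCommGroup V] [Module ℂ V] [AddCommGroup W] [Module ℂ W]
variable {p : V →ₗ[ℂ] W →ₗ[ℂ] ℂ}

attribute [local instance] LieRing.ofAssociativeRing
attribute [local instance] nonUnitalRing

section Compression

variable {ι : Type*} [Fintype ι]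

/-- The coordinates of the projection of a vector to the span of a finite dual system. -/
def coords (p : V →ₗ[ℂ] W →ₗ[ℂ] ℂ) (f : ι → W) : V →ₗ[ℂ] (ι → ℂ) :=
  LinearMap.pi fun i => p.flip (f i)

theorem linearCombination_coords (e : ι → V) (f : ι → W) (v : V) :
    Fintype.linearCombination ℂ e (coords p f v) = actV p (idem p e f) v := by
  simp [actV_idem, Fintype.linearCombination_apply, coords]

variable [DecidableEq ι]

theorem IsDual.coords_linearCombination {e : ι → V} {f : ι → W} (h : IsDual p e f) (a : ι → ℂ) :
    coords p f (Fintype.linearCombination ℂ e a) = a := by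
  ext i
  simp [Fintype.linearCombination_apply, coords, h _ _]

/-- The embedding of the endomorphisms of `ι → ℂ` into `gl(V, W)` given by a dual system. -/
def ofEnd (p : V →ₗ[ℂ] W →ₗ[ℂ] ℂ) (e : ι → V) (f : ι → W) :
    Module.End ℂ (ι → ℂ) →ₗ[ℂ] MackeyGL p where
  toFun x := ∑ j, tmul p (Fintype.linearCombination ℂ e (x (Pi.single j 1))) (f j)
  map_add' x y := by simp only [LinearMap.add_apply, map_add, add_tmul, Finset.sum_add_distrib]
  map_smul' c x := by
    simp only [LinearMap.smul_apply, map_smul, smul_tmul, Finset.smul_sum, RingHom.id_apply]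

theorem ofEnd_apply (e : ι → V) (f : ι → W) (x : Module.End ℂ (ι → ℂ)) :
    ofEnd p e f x = ∑ j, tmul p (Fintype.linearCombination ℂ e (x (Pi.single j 1))) (f j) := rfl

/-- The compression of the action of `gl(V, W)` on `V` to the span of a dual system. -/
def compress (p : V →ₗ[ℂ] W →ₗ[ℂ] ℂ) (e : ι → V) (f : ι → W) :
    MackeyGL p →ₗ[ℂ] Module.End ℂ (ι → ℂ) where
  toFun x := coords p f ∘ₗ actV p x ∘ₗ Fintype.linearCombination ℂ e
  map_add' x y := by ext; simp
  map_smul' c x := by ext; simp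

theorem compress_apply (e : ι → V) (f : ι → W) (x : MackeyGL p) (a : ι → ℂ) :
    compress p e f x a = coords p f (actV p x (Fintype.linearCombination ℂ e a)) := rfl

theorem ofEnd_compress (e : ι → V) (f : ι → W) (x : MackeyGL p) :
    ofEnd p e f (compress p e f x) = idem p e f * x * idem p e f := by
  simp only [ofEnd_apply, compress_apply, linearCombination_coords]
  conv_rhs => rhs; rw [idem]
  rw [Finset.mul_sum]
  simp only [mul_tmul, actV_mul]
  simp [Fintype.linearCombination_apply_single]

/-- The dual system obtained from a dual system by a change of basis. -/
def changeV {κ : Type*} (b : Module.Basis κ ℂ (ι → ℂ)) (e : ι → V) (k : κ) : V :=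
  Fintype.linearCombination ℂ e (b k)

/-- The dual system obtained from a dual system by a change of basis. -/
def changeW {κ : Type*} (b : Module.Basis κ ℂ (ι → ℂ)) (f : ι → W) (k : κ) : W :=
  ∑ j, b.repr (Pi.single j 1) k • f j

theorem ofEnd_eq_sum {κ : Type*} [Fintype κ] (b : Module.Basis κ ℂ (ι → ℂ)) (e : ι → V) (f : ι → W)
    (x : Module.End ℂ (ι → ℂ)) :
    ofEnd p e f x =
      ∑ k, tmul p (Fintype.linearCombination ℂ e (x (b k))) (changeW b f k) := by
  simp only [changeW, tmul_sum, tmul_smul, ofEnd_apply]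
  rw [Finset.sum_comm]
  refine Finset.sum_congr rfl fun j _ => ?_
  conv_lhs => rw [← b.sum_repr (Pi.single j 1)]
  simp only [map_sum, map_smul, sum_tmul, smul_tmul]

theorem ofEnd_one (e : ι → V) (f : ι → W) : ofEnd p e f 1 = idem p e f := by
  simp [ofEnd_apply, Fintype.linearCombination_apply_single, idem]

/-- The idempotent is the image of the identity endomorphism, hence independent of the basis. -/
theorem idem_change {κ : Type*} [Fintype κ] (b : Module.Basis κ ℂ (ι → ℂ)) (e : ι → V)
    (f : ι → W) : idem p (changeV b e) (changeW b f) = idem p e f := by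
  rw [← ofEnd_one e f, ofEnd_eq_sum b]; rfl

namespace IsDual

variable {e : ι → V} {f : ι → W}

theorem change (h : IsDual p e f) {κ : Type*} [DecidableEq κ] (b : Module.Basis κ ℂ (ι → ℂ)) :
    IsDual p (changeV b e) (changeW b f) := by
  intro k l
  have h1 : ∀ j, p (changeV b e k) (f j) = b k j := fun j =>
    congrFun (h.coords_linearCombination (b k)) j
  simp only [changeW, map_sum, map_smul, h1]
  have h2 := congrArg (fun a => b.repr a l) (pi_eq_sum_univ' (b k))
  simp only [map_sum, map_smul, Module.Basis.repr_self, Finsupp.single_apply,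
    Finsupp.coe_finsetSum, Finset.sum_apply, Finsupp.smul_apply, smul_eq_mul] at h2
  rw [h2]
  exact Finset.sum_congr rfl fun j _ => mul_comm _ _

theorem compress_ofEnd (h : IsDual p e f) (x : Module.End ℂ (ι → ℂ)) :
    compress p e f (ofEnd p e f x) = x := by
  refine LinearMap.ext fun a => ?_
  rw [compress_apply, ofEnd_apply, map_sum, LinearMap.sum_apply]
  have h1 : ∀ j, p (Fintype.linearCombination ℂ e a) (f j) = a j := fun j =>
    congrFun (h.coords_linearCombination a) j
  simp only [actV_tmul, h1, map_sum, map_smul, h.coords_linearCombination]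
  conv_rhs => rw [pi_eq_sum_univ' a]
  simp

theorem ofEnd_mul (h : IsDual p e f) (x y : Module.End ℂ (ι → ℂ)) :
    ofEnd p e f (x * y) = ofEnd p e f x * ofEnd p e f y := by
  rw [ofEnd_apply e f y, Finset.mul_sum, ofEnd_apply]
  refine Finset.sum_congr rfl fun j _ => ?_
  rw [mul_tmul]
  congr 1
  have h1 : ∀ a j, p (Fintype.linearCombination ℂ e a) (f j) = a j := fun a j =>
    congrFun (h.coords_linearCombination a) j
  simp only [ofEnd_apply, map_sum, LinearMap.sum_apply, actV_tmul, h1, Module.End.mul_apply]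
  conv_lhs => rw [pi_eq_sum_univ' (y (Pi.single j 1))]
  simp only [map_sum, map_smul]

theorem ofEnd_lie (h : IsDual p e f) (x y : Module.End ℂ (ι → ℂ)) :
    ofEnd p e f ⁅x, y⁆ = ⁅ofEnd p e f x, ofEnd p e f y⁆ := by
  rw [LieRing.of_associative_ring_bracket, map_sub, h.ofEnd_mul, h.ofEnd_mul, lie_def]

theorem tr_ofEnd (h : IsDual p e f) (x : Module.End ℂ (ι → ℂ)) :
    tr p (ofEnd p e f x) = LinearMap.trace ℂ (ι → ℂ) x := by
  have h1 : ∀ a j, p (Fintype.linearCombination ℂ e a) (f j) = a j := fun a j =>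
    congrFun (h.coords_linearCombination a) j
  rw [LinearMap.trace_eq_matrix_trace ℂ (Pi.basisFun ℂ ι)]
  simp [ofEnd_apply, MackeyGL.tr_tmul, h1, Matrix.trace]

theorem ofEnd_compress_of_mem {x : MackeyGL p}
    (hx : x ∈ corner (idem p e f)) : ofEnd p e f (compress p e f x) = x := by
  rw [ofEnd_compress, hx.1, hx.2.1]

theorem ofEnd_mem (h : IsDual p e f) {x : Module.End ℂ (ι → ℂ)}
    (hx : LinearMap.trace ℂ (ι → ℂ) x = 0) : ofEnd p e f x ∈ corner (idem p e f) := by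
  refine ⟨?_, ?_, by rw [h.tr_ofEnd, hx]⟩ <;> rw [← ofEnd_one, ← h.ofEnd_mul] <;> simp

/-- A Cartan subalgebra of a standard `sl n` is diagonal in a suitable dual system. -/
theorem exists_diagonal (h : IsDual p e f) {𝔥 : Type*} [LieRing 𝔥] [LieAlgebra ℂ 𝔥]
    [LieRing.IsNilpotent 𝔥] (ψ : 𝔥 →ₗ⁅ℂ⁆ MackeyGL p) (h₁ : ∀ z, ψ z ∈ corner (idem p e f))
    (h₂ : ∀ x ∈ corner (idem p e f),
      (∀ z, ∃ N : ℕ, (LieAlgebra.ad ℂ (MackeyGL p) (ψ z) ^ N) x = 0) → ∃ z, ψ z = x) :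
    ∃ (m : ℕ) (e' : Fin m → V) (f' : Fin m → W), IsDual p e' f' ∧ idem p e' f' = idem p e f ∧
      ∀ x, (∃ z, ψ z = x) ↔
        x ∈ Submodule.span ℂ (Set.range fun k => tmul p (e' k) (f' k)) ∧ tr p x = 0 := by
  have hc : ∀ z, ofEnd p e f (compress p e f (ψ z)) = ψ z := fun z =>
    ofEnd_compress_of_mem (h₁ z)
  let φ : 𝔥 →ₗ⁅ℂ⁆ Module.End ℂ (ι → ℂ) :=
    { compress p e f ∘ₗ (ψ : 𝔥 →ₗ[ℂ] MackeyGL p) with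
      map_lie' := fun {x y} => by
        simp only [AddHom.toFun_eq_coe, LinearMap.coe_toAddHom, LinearMap.comp_apply,
          LieHom.coe_toLinearMap, LieHom.map_lie]
        -- Compression respects brackets only on the corner, so elements are first rewritten as
        -- images of `ofEnd`.
        rw [← hc x, ← hc y, ← h.ofEnd_lie, h.compress_ofEnd, h.compress_ofEnd, h.compress_ofEnd] }
  have hφ : ∀ z, φ z = compress p e f (ψ z) := fun z => rfl
  have hψ : ∀ z, ofEnd p e f (φ z) = ψ z := hc
  have had : ∀ z x (N : ℕ), (LieAlgebra.ad ℂ (MackeyGL p) (ψ z) ^ N) (ofEnd p e f x) =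
      ofEnd p e f ((LieAlgebra.ad ℂ (Module.End ℂ (ι → ℂ)) (φ z) ^ N) x) := by
    intro z x N
    induction N with
    | zero => simp
    | succ N ih =>
      rw [pow_succ', Module.End.mul_apply, ih, pow_succ', Module.End.mul_apply,
        LieAlgebra.ad_apply, LieAlgebra.ad_apply, h.ofEnd_lie, hψ]
  obtain ⟨m, b, hb⟩ := exists_basis_mem_range_iff φ
    (fun z => by rw [← h.tr_ofEnd, hψ]; exact (h₁ z).2.2)
    (fun x hx hz => by
      obtain ⟨z, hz⟩ := h₂ _ (h.ofEnd_mem hx) fun z => by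
        obtain ⟨N, hN⟩ := hz z
        exact ⟨N, by rw [had, hN, map_zero]⟩
      exact ⟨z, by
        change φ z = x
        rw [hφ, hz, h.compress_ofEnd]⟩)
  refine ⟨m, changeV b e, changeW b f, h.change b, idem_change b e f, fun x => ⟨?_, ?_⟩⟩
  · rintro ⟨z, rfl⟩
    refine ⟨?_, (h₁ z).2.2⟩
    rw [← hψ, ofEnd_eq_sum b]
    refine Submodule.sum_mem _ fun k _ => ?_
    have hd : φ z (b k) = b.repr (φ z (b k)) k • b k := by
      refine b.ext_elem fun l => ?_
      by_cases hkl : k = l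
      · subst hkl; simp
      · rw [((hb (φ z)).1 ⟨z, rfl⟩).2 k l hkl]; simp [hkl]
    rw [hd, map_smul, smul_tmul]
    exact Submodule.smul_mem _ _ (Submodule.subset_span ⟨k, rfl⟩)
  · rintro ⟨hx, htr⟩
    obtain ⟨c, rfl⟩ := (Submodule.mem_span_range_iff_exists_fun ℂ).1 hx
    have hx' : ofEnd p e f (b.constr ℂ fun k => c k • b k) =
        ∑ k, c k • tmul p (changeV b e k) (changeW b f k) := by
      rw [ofEnd_eq_sum b]
      simp [smul_tmul, changeV]
    obtain ⟨z, hz⟩ := (hb (b.constr ℂ fun k => c k • b k)).2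
      ⟨by rw [← h.tr_ofEnd, hx', htr], fun k l hkl => by
        simp [hkl]⟩
    exact ⟨z, by rw [← hx', ← hψ]; exact congrArg _ hz⟩

end IsDual

end Compression

theorem hasTrivialIdeals_map (g : LieSubalgebra ℂ (MackeySL p)) [LieAlgebra.IsSimple ℂ g] :
    HasTrivialIdeals (g.map (MackeySL p).incl) := by
  intro J hJ hlie
  let K : LieIdeal ℂ g :=
    { J.comap ((MackeySL p).toSubmodule.subtype ∘ₗ g.toSubmodule.subtype) with
      lie_mem := fun {x y} hy => hlie _ ⟨x, x.2, rfl⟩ _ hy }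
  have hK : ∀ y : g, y ∈ K ↔ ((y : MackeySL p) : MackeyGL p) ∈ J := fun y => Iff.rfl
  rcases LieAlgebra.IsSimple.eq_bot_or_eq_top (R := ℂ) K with h | h
  · left
    rw [eq_bot_iff]
    intro x hx
    obtain ⟨y, hy, rfl⟩ := hJ hx
    have : (⟨y, hy⟩ : g) ∈ K := hx
    rw [h, LieSubmodule.mem_bot] at this
    have h0 : y = 0 := congrArg Subtype.val this
    rw [h0]; exact zero_mem _
  · right
    rintro x ⟨y, hy, rfl⟩
    have : (⟨y, hy⟩ : g) ∈ K := h ▸ LieSubmodule.mem_top _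
    exact this

/-- Combines the corner theorem for `g` with the diagonalisation of `h`, which is applicable because
a Cartan subalgebra equals its zero root subalgebra. -/
theorem exists_standard (g : LieSubalgebra ℂ (MackeySL p)) [FiniteDimensional ℂ g]
    [LieAlgebra.IsSimple ℂ g] (h : LieSubalgebra ℂ g) [h.IsCartanSubalgebra] {n : ℕ} (hn : 3 ≤ n)
    {e : Fin n → V} {f : Fin n → W} (hef : IsDual p e f)
    (hu : ∀ i j, i ≠ j → tmul p (e i) (f j) ∈ g.map (MackeySL p).incl) :
    ∃ (m : ℕ) (e' : Fin m → V) (f' : Fin m → W), 3 ≤ m ∧ IsDual p e' f' ∧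
      (∀ y : MackeySL p, y ∈ g ↔ (y : MackeyGL p) ∈ corner (idem p e' f')) ∧
      ∀ x : MackeyGL p, (∃ y ∈ h.map g.incl, (y : MackeyGL p) = x) ↔
        x ∈ Submodule.span ℂ (Set.range fun k => tmul p (e' k) (f' k)) ∧ tr p x = 0 := by
  have : FiniteDimensional ℂ (g.map (MackeySL p).incl) :=
    inferInstanceAs (FiniteDimensional ℂ (g.toSubmodule.map (MackeySL p).toSubmodule.subtype))
  obtain ⟨m, e', f', hm, hd, hc⟩ := hef.exists_eq_corner hn (hasTrivialIdeals_map g) hu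
  have hg : ∀ y : MackeySL p, y ∈ g ↔ (y : MackeyGL p) ∈ corner (idem p e' f') := by
    intro y
    rw [← hc]
    constructor
    · exact fun hy => ⟨y, hy, rfl⟩
    · rintro ⟨z, hz, hzy⟩
      exact Subtype.ext hzy ▸ hz
  let ψ : h →ₗ⁅ℂ⁆ MackeyGL p := (MackeySL p).incl.comp (g.incl.comp h.incl)
  have had : ∀ (z : h) (x : g) (N : ℕ),
      (((LieModule.toEnd ℂ h g z ^ N) x : g) : MackeySL p) =
      (LieAlgebra.ad ℂ (MackeyGL p) (ψ z) ^ N) ((x : MackeySL p) : MackeyGL p) := by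
    intro z x N
    induction N with
    | zero => rfl
    | succ N ih =>
      rw [pow_succ', Module.End.mul_apply, pow_succ', Module.End.mul_apply, ← ih]
      rfl
  obtain ⟨m', e'', f'', hd', hE, hx⟩ := hd.exists_diagonal ψ (fun z => (hg _).1 z.1.2)
    fun x hx hz => by
      have hxg := (hg ⟨x, hx.2.2⟩).2 hx
      have : (⟨⟨x, hx.2.2⟩, hxg⟩ : g) ∈ LieAlgebra.zeroRootSubalgebra ℂ g h := by
        rw [LieAlgebra.mem_zeroRootSubalgebra]
        intro z
        obtain ⟨N, hN⟩ := hz z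
        refine ⟨N, ?_⟩
        have := had z ⟨⟨x, hx.2.2⟩, hxg⟩ N
        rw [hN] at this
        exact Subtype.ext (Subtype.ext this)
      rw [LieAlgebra.zeroRootSubalgebra_eq_of_is_cartan] at this
      exact ⟨⟨_, this⟩, rfl⟩
  -- Both sizes are the trace of the same idempotent.
  have hmm : m' = m := by
    have := hd'.tr_idem
    rw [hE, hd.tr_idem] at this
    simpa using this.symm
  refine ⟨m', e'', f'', hmm ▸ hm, hd', by rwa [hE], fun x => (Iff.trans ?_ (hx x))⟩
  constructor
  · rintro ⟨y, ⟨z, hz, rfl⟩, rfl⟩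
    exact ⟨⟨z, hz⟩, rfl⟩
  · rintro ⟨z, rfl⟩
    exact ⟨_, ⟨z.1, z.2, rfl⟩, rfl⟩

/-! ### Gluing the diagonal systems into a basis -/

namespace IsDual

/-- If the traceless diagonal elements of a dual system are diagonal in a second dual system, then
the diagonal rank one idempotents of the first system are among those of the second. -/
theorem exists_diag_eq {m n : ℕ} (hm : 3 ≤ m) {e : Fin m → V} {f : Fin m → W} {e' : Fin n → V}
    {f' : Fin n → W} (h : IsDual p e f) (h' : IsDual p e' f')
    (hle : ∀ x, x ∈ Submodule.span ℂ (Set.range fun k => tmul p (e k) (f k)) → tr p x = 0 →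
      x ∈ Submodule.span ℂ (Set.range fun k => tmul p (e' k) (f' k))) (a : Fin m) :
    ∃ b, tmul p (e a) (f a) = tmul p (e' b) (f' b) := by
  have hsub : ∀ b, tmul p (e a) (f a) - tmul p (e b) (f b) ∈
      Submodule.span ℂ (Set.range fun k => tmul p (e' k) (f' k)) := fun b =>
    hle _ (sub_mem (Submodule.subset_span ⟨a, rfl⟩) (Submodule.subset_span ⟨b, rfl⟩))
      (by simp [h.tr_tmul])
  obtain ⟨b, hb⟩ : ∃ b, b ∉ ({a} : Finset (Fin m)) := by
    by_contra! hb
    have := Finset.card_le_card (fun b _ => hb b : Finset.univ ⊆ ({a} : Finset (Fin m)))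
    simp at this
    omega
  obtain ⟨c, hc⟩ : ∃ c, c ∉ ({a, b} : Finset (Fin m)) := by
    by_contra! hb
    have := Finset.card_le_card (fun c _ => hb c : Finset.univ ⊆ ({a, b} : Finset (Fin m)))
    have := this.trans Finset.card_le_two
    simp only [Finset.card_univ, Fintype.card_fin] at this
    omega
  simp only [Finset.mem_insert, Finset.mem_singleton, not_or] at hb hc
  -- The span of the second system's diagonal idempotents is closed under products, so it contains
  -- the left side. Here `m ≥ 3` provides distinct `a`, `b`, `c`.
  have hprod : tmul p (e a) (f a) = (tmul p (e a) (f a) - tmul p (e b) (f b)) *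
      (tmul p (e a) (f a) - tmul p (e c) (f c)) := by
    simp [sub_mul, mul_sub, h.tmul_mul_tmul, hc.1, hc.2, Ne.symm hb]
  obtain ⟨s, hs⟩ := (Submodule.mem_span_range_iff_exists_fun ℂ).1 (hsub b)
  obtain ⟨t, ht⟩ := (Submodule.mem_span_range_iff_exists_fun ℂ).1 (hsub c)
  have hst : tmul p (e a) (f a) = ∑ l, (s l * t l) • tmul p (e' l) (f' l) := by
    rw [hprod, ← hs, ← ht]
    simp [Finset.sum_mul, Finset.mul_sum, h'.tmul_mul_tmul, mul_smul_comm, smul_mul_assoc,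
      smul_smul, mul_comm]
  have htr : tr p (tmul p (e a) (f a)) = 1 := by simp [h.tr_tmul]
  obtain ⟨l, hl⟩ : ∃ l, s l * t l ≠ 0 := by
    by_contra! hl
    rw [hst] at htr
    simp [hl] at htr
  refine ⟨l, ?_⟩
  -- Since `e a ⊗ f a` has rank one, this product is also a multiple of it. The two idempotents are
  -- therefore proportional, and equal because both have trace one.
  have h1 : tmul p (e a) (f a) * tmul p (e' l) (f' l) * tmul p (e a) (f a) =
      (s l * t l * (s l * t l)) • tmul p (e' l) (f' l) := by
    rw [hst]
    simp [Finset.sum_mul, Finset.mul_sum, h'.tmul_mul_tmul, mul_smul_comm, smul_mul_assoc,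
      smul_smul]
  rw [tmul_mul, MackeyGL.tmul_mul_tmul] at h1
  set r := p (e a) (actW p (tmul p (e' l) (f' l)) (f a))
  have h2 := congrArg (tr p) h1
  simp only [map_smul, h.tr_tmul, h'.tr_tmul, if_true, smul_eq_mul, mul_one] at h2
  rw [h2] at h1
  exact smul_right_injective _ (mul_ne_zero hl hl) h1

end IsDual

theorem exists_isDual (hp : p.Nondegenerate) (hV : ¬ FiniteDimensional ℂ V) (n : ℕ) :
    ∃ (e : Fin n → V) (f : Fin n → W), IsDual p e f := by
  induction n with
  | zero => exact ⟨Fin.elim0, Fin.elim0, fun i => i.elim0⟩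
  | succ n ih =>
    obtain ⟨e, f, h⟩ := ih
    obtain ⟨v, hv, hv0⟩ : ∃ v, coords p f v = 0 ∧ v ≠ 0 := by
      by_contra! hc
      exact hV (FiniteDimensional.of_injective (coords p f)
        ((injective_iff_map_eq_zero _).2 hc))
    have hv' : ∀ i, p v (f i) = 0 := fun i => congrFun hv i
    obtain ⟨w, hw⟩ : ∃ w, p v w ≠ 0 := by
      by_contra! hc
      exact hv0 (hp.1 v hc)
    refine ⟨_, _, h.cons (v := (p v w)⁻¹ • v) (w := w - ∑ i, p (e i) w • f i) ?_ (fun i => ?_)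
      fun i => ?_⟩
    · simp [hv', hw]
    · simp [hv']
    · simp [h _ _]

/-- A family of finite dual systems, directed by inclusion of the sets of diagonal rank one
idempotents, that exhausts `V` and `W` gives a basis of `V` whose dual family spans `W`. -/
theorem exists_isSpanningDualFamily {I : Type*} [Nonempty I] {n : I → ℕ} {e : ∀ i, Fin (n i) → V}
    {f : ∀ i, Fin (n i) → W} (h : ∀ i, IsDual p (e i) (f i))
    (hdir : ∀ i j, ∃ k, (∀ a, ∃ c, tmul p (e i a) (f i a) = tmul p (e k c) (f k c)) ∧
      ∀ a, ∃ c, tmul p (e j a) (f j a) = tmul p (e k c) (f k c))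
    (hV : ∀ v, ∃ i, v ∈ Submodule.span ℂ (Set.range (e i)))
    (hW : ∀ w, ∃ i, w ∈ Submodule.span ℂ (Set.range (f i))) :
    ∃ (ι : Type u) (b : Module.Basis ι ℂ V) (w : ι → W), IsSpanningDualFamily p b w ∧
      ∀ x, x ∈ Submodule.span ℂ (Set.range fun γ : ι × ι =>
          tmul p (b γ.1) (w γ.1) - tmul p (b γ.2) (w γ.2)) ↔
        ∃ i, x ∈ Submodule.span ℂ (Set.range fun k => tmul p (e i k) (f i k)) ∧ tr p x = 0 := by
  classical
  let Q : Set (MackeyGL p) := {q | ∃ i a, q = tmul p (e i a) (f i a)}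
  have hQ : ∀ q : Q, ∃ (v : V) (w : W), tmul p v w = q ∧ p v w = 1 := by
    rintro ⟨q, i, a, rfl⟩
    exact ⟨e i a, f i a, rfl, by simp [h i a a]⟩
  choose v w hvw hone using hQ
  have hcommon : ∀ q q' : Q, ∃ k c c', (q : MackeyGL p) = tmul p (e k c) (f k c) ∧
      (q' : MackeyGL p) = tmul p (e k c') (f k c') := by
    rintro ⟨q, i, a, rfl⟩ ⟨q', j, a', rfl⟩
    obtain ⟨k, h1, h2⟩ := hdir i j
    obtain ⟨c, hc⟩ := h1 a
    obtain ⟨c', hc'⟩ := h2 a'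
    exact ⟨k, c, c', hc, hc'⟩
  have hdual : IsDual p v w := by
    intro q q'
    split_ifs with hqq
    · rw [hqq, hone]
    · obtain ⟨k, c, c', hc, hc'⟩ := hcommon q q'
      have hcc : c ≠ c' := fun hcc => hqq (Subtype.ext (by rw [hc, hc', hcc]))
      -- Distinct idempotents of a common dual system are orthogonal; the factor `p (v q) (w q')` of
      -- this product must then vanish.
      have h0 : (q' : MackeyGL p) * q = 0 := by
        rw [hc, hc', (h k).tmul_mul_tmul, if_neg hcc]
      rw [← hvw, ← hvw, MackeyGL.tmul_mul_tmul] at h0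
      have h1 := congrArg (fun x => tr p (x * tmul p (v q) (w q'))) h0
      simpa [smul_mul_assoc, MackeyGL.tmul_mul_tmul, MackeyGL.tr_tmul, hone] using h1
  have hli : LinearIndependent ℂ v := by
    rw [linearIndependent_iff']
    intro s c hc q hq
    have := congrArg (fun x => p x (w q)) hc
    simpa [hdual _ _, hq] using this
  have hspan : ∀ x, x ∈ Submodule.span ℂ (Set.range v) := by
    intro x
    obtain ⟨i, hi⟩ := hV x
    refine Submodule.span_le.2 ?_ hi
    rintro _ ⟨a, rfl⟩
    have h1 := congrArg (fun y => actV p y (e i a)) (hvw ⟨_, i, a, rfl⟩)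
    simp only [actV_tmul, h i a a, if_true, one_smul] at h1
    rw [← h1]
    exact Submodule.smul_mem _ _ (Submodule.subset_span ⟨_, rfl⟩)
  have hspan' : ∀ x, x ∈ Submodule.span ℂ (Set.range w) := by
    intro x
    obtain ⟨i, hi⟩ := hW x
    refine Submodule.span_le.2 ?_ hi
    rintro _ ⟨a, rfl⟩
    have h1 := congrArg (fun y => actW p y (f i a)) (hvw ⟨_, i, a, rfl⟩)
    simp only [actW_tmul, h i a a, if_true, one_smul] at h1
    rw [← h1]
    exact Submodule.smul_mem _ _ (Submodule.subset_span ⟨_, rfl⟩)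
  let E : Q ≃ Set.range v := Equiv.ofInjective v hli.injective
  let b₀ : Module.Basis Q ℂ V := Module.Basis.mk hli fun x _ => hspan x
  have hb₀ : ∀ q, b₀ q = v q := fun q => by simp [b₀]
  -- `Q` lives in the universe of `V ⊗ W`; reindexing by the range of `v` brings the index type into
  -- the universe of `V`.
  refine ⟨Set.range v, b₀.reindex E, w ∘ E.symm, ⟨fun γ => ?_, ?_⟩, fun x => ⟨fun hx => ?_, ?_⟩⟩
  · refine (b₀.reindex E).ext fun γ' => ?_
    have hd : ∀ q q', p (b₀ q) (w q') = if q = q' then 1 else 0 := fun q q' => by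
      rw [hb₀, hdual]
    simp [hd, Finsupp.single_apply]
  · rw [Set.range_comp, E.symm.range_eq_univ, Set.image_univ, eq_top_iff]
    exact fun x _ => hspan' x
  · induction hx using Submodule.span_induction with
    | mem x hx =>
      obtain ⟨⟨γ, γ'⟩, rfl⟩ := hx
      obtain ⟨k, c, c', hc, hc'⟩ := hcommon (E.symm γ) (E.symm γ')
      simp only [Module.Basis.reindex_apply, hb₀, Function.comp_apply, hvw, hc, hc']
      exact ⟨k, sub_mem (Submodule.subset_span ⟨c, rfl⟩) (Submodule.subset_span ⟨c', rfl⟩),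
        by simp [(h k).tr_tmul]⟩
    | zero => exact ⟨Classical.arbitrary I, zero_mem _, map_zero _⟩
    | add x y _ _ hx hy =>
      obtain ⟨i, hi, hx⟩ := hx
      obtain ⟨j, hj, hy⟩ := hy
      obtain ⟨k, h1, h2⟩ := hdir i j
      refine ⟨k, add_mem (Submodule.span_mono ?_ hi) (Submodule.span_mono ?_ hj),
        by rw [map_add, hx, hy, add_zero]⟩
      · rintro _ ⟨a, rfl⟩
        exact (h1 a).imp fun c hc => hc.symm
      · rintro _ ⟨a, rfl⟩
        exact (h2 a).imp fun c hc => hc.symm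
    | smul c x _ hx =>
      obtain ⟨i, hi, hx⟩ := hx
      exact ⟨i, Submodule.smul_mem _ _ hi, by rw [map_smul, hx, smul_zero]⟩
  · rintro ⟨i, hi, htr⟩
    obtain ⟨c, rfl⟩ := (Submodule.mem_span_range_iff_exists_fun ℂ).1 hi
    rcases isEmpty_or_nonempty (Fin (n i)) with he | ⟨⟨o⟩⟩
    · simp
    have hc : ∑ k, c k = 0 := by simpa [(h i).tr_tmul] using htr
    have : ∑ k, c k • tmul p (e i k) (f i k) =
        ∑ k, c k • (tmul p (e i k) (f i k) - tmul p (e i o) (f i o)) := by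
      simp only [smul_sub, Finset.sum_sub_distrib]
      rw [← Finset.sum_smul, hc, zero_smul, sub_zero]
    rw [this]
    refine Submodule.sum_mem _ fun k _ => Submodule.smul_mem _ _ (Submodule.subset_span
      ⟨(E ⟨_, i, k, rfl⟩, E ⟨_, i, o, rfl⟩), ?_⟩)
    simp [hb₀, hvw]

/-- Evaluating at a vector that pairs nontrivially with `w` turns the hypothesis into `E v = v`. -/
theorem mem_span_of_idem_mul {ι : Type*} [Fintype ι] {e : ι → V} {f : ι → W}
    (hp : p.Nondegenerate) {v : V} {w : W} (hw : w ≠ 0)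
    (h : idem p e f * tmul p v w = tmul p v w) : v ∈ Submodule.span ℂ (Set.range e) := by
  obtain ⟨v', hv'⟩ : ∃ v', p v' w ≠ 0 := by
    by_contra! hc
    exact hw (hp.2 w hc)
  have h1 := congrArg (fun x => actV p x v') h
  simp only [mul_tmul, actV_tmul] at h1
  rw [← smul_right_injective _ hv' h1, actV_idem]
  exact Submodule.sum_mem _ fun i _ => Submodule.smul_mem _ _ (Submodule.subset_span ⟨i, rfl⟩)

theorem mem_span_of_mul_idem {ι : Type*} [Fintype ι] {e : ι → V} {f : ι → W}
    (hp : p.Nondegenerate) {v : V} {w : W} (hv : v ≠ 0)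
    (h : tmul p v w * idem p e f = tmul p v w) : w ∈ Submodule.span ℂ (Set.range f) := by
  obtain ⟨w', hw'⟩ : ∃ w', p v w' ≠ 0 := by
    by_contra! hc
    exact hv (hp.1 v hc)
  have h1 := congrArg (fun x => actW p x w') h
  simp only [tmul_mul, actW_tmul] at h1
  rw [← smul_right_injective _ hw' h1, actW_idem]
  exact Submodule.sum_mem _ fun i _ => Submodule.smul_mem _ _ (Submodule.subset_span ⟨i, rfl⟩)

theorem exists_ne_zero_of_functional {M : Type*} [AddCommGroup M] [Module ℂ M]
    (hM : ¬ FiniteDimensional ℂ M) (φ : M →ₗ[ℂ] ℂ) : ∃ x, x ≠ 0 ∧ φ x = 0 := by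
  by_contra! hc
  exact hM (FiniteDimensional.of_injective φ
    ((injective_iff_map_eq_zero φ).2 fun x hx => by_contra fun h0 => hc x h0 hx))

/-- Every local Cartan subalgebra of `sl(V, W)` is the diagonal subalgebra of a basis of `V` whose
dual family spans `W`. -/
theorem exists_of_isLocalCartanSubalgebra (hp : p.Nondegenerate) (hV : ¬ FiniteDimensional ℂ V)
    (hW : ¬ FiniteDimensional ℂ W) (H : LieSubalgebra ℂ (MackeySL p))
    (hH : IsLocalCartanSubalgebra H) :
    ∃ (ι : Type u) (b : Module.Basis ι ℂ V) (w : ι → W), IsSpanningDualFamily p b w ∧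
      H.toSubmodule.map (MackeySL p).toSubmodule.subtype =
        Submodule.span ℂ (Set.range fun γ : ι × ι =>
          tmul p (b γ.1) (w γ.1) - tmul p (b γ.2) (w γ.2)) := by
  obtain ⟨I, _, _, _, g, h, hg, hfin, hsimple, hex, hcartan, hh, hmem⟩ := hH
  obtain ⟨e₀, f₀, h₀⟩ := exists_isDual hp hV 3
  have hu₀ : ∀ ij : Fin 3 × Fin 3, ∃ i, ij.1 ≠ ij.2 →
      tmul p (e₀ ij.1) (f₀ ij.2) ∈ (g i).map (MackeySL p).incl := by
    intro ij
    by_cases hij : ij.1 = ij.2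
    · exact ⟨Classical.arbitrary I, fun hc => absurd hij hc⟩
    · obtain ⟨i, hi⟩ := hex ⟨tmul p (e₀ ij.1) (f₀ ij.2), by
        change tr p _ = 0
        rw [h₀.tr_tmul, if_neg hij]⟩
      exact ⟨i, fun _ => ⟨_, hi, rfl⟩⟩
  choose i₁ hi₁ using hu₀
  -- Beyond `i₀` every member of the system contains one fixed standard `sl 3`.
  obtain ⟨i₀, hi₀⟩ := Finite.exists_le i₁
  have hstd : ∀ j : {j // i₀ ≤ j}, ∃ (m : ℕ) (e : Fin m → V) (f : Fin m → W), 3 ≤ m ∧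
      IsDual p e f ∧ (∀ y : MackeySL p, y ∈ g j ↔ (y : MackeyGL p) ∈ corner (idem p e f)) ∧
      ∀ x : MackeyGL p, (∃ y ∈ (h j).map (g j).incl, (y : MackeyGL p) = x) ↔
        x ∈ Submodule.span ℂ (Set.range fun k => tmul p (e k) (f k)) ∧ tr p x = 0 := by
    rintro ⟨j, hj⟩
    have := hfin j
    have := hsimple j
    have := hcartan j
    refine exists_standard (g j) (h j) le_rfl h₀ fun a b hab => ?_
    obtain ⟨y, hy, hyx⟩ := hi₁ (a, b) hab
    exact ⟨y, hg ((hi₀ _).trans hj) hy, hyx⟩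
  choose m e f hm hd hgj hhj using hstd
  have hle : ∀ i j : {j // i₀ ≤ j}, i.1 ≤ j.1 → ∀ a, ∃ c,
      tmul p (e i a) (f i a) = tmul p (e j c) (f j c) := by
    intro i j hij
    refine (hd i).exists_diag_eq (hm i) (hd j) fun x hx htr => ?_
    obtain ⟨y, hy, hyx⟩ := (hhj i x).2 ⟨hx, htr⟩
    exact ((hhj j x).1 ⟨y, hh hij hy, hyx⟩).1
  have hup : ∀ y : MackeySL p, ∃ j : {j // i₀ ≤ j},
      (y : MackeyGL p) ∈ corner (idem p (e j) (f j)) := by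
    intro y
    obtain ⟨i, hi⟩ := hex y
    obtain ⟨j, hij, hj⟩ := exists_ge_ge i i₀
    exact ⟨⟨j, hj⟩, (hgj ⟨j, hj⟩ y).1 (hg hij hi)⟩
  have : Nonempty {j // i₀ ≤ j} := ⟨⟨i₀, le_rfl⟩⟩
  obtain ⟨ι, b, w, hbw, hspan⟩ := exists_isSpanningDualFamily hd
    (fun i j => by
      obtain ⟨k, hik, hjk⟩ := exists_ge_ge i.1 j.1
      exact ⟨⟨k, i.2.trans hik⟩, hle _ _ hik, hle _ _ hjk⟩)
    (fun v => by
      -- A nonzero `w` orthogonal to `v` makes `v ⊗ w` traceless, so it lies in some corner.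
      obtain ⟨w, hw, hvw⟩ := exists_ne_zero_of_functional hW (p v)
      obtain ⟨j, hj⟩ := hup ⟨tmul p v w, (tr_tmul p v w).trans hvw⟩
      exact ⟨j, mem_span_of_idem_mul hp hw hj.1⟩)
    (fun w => by
      obtain ⟨v, hv, hvw⟩ := exists_ne_zero_of_functional hV (p.flip w)
      obtain ⟨j, hj⟩ := hup ⟨tmul p v w, (tr_tmul p v w).trans hvw⟩
      exact ⟨j, mem_span_of_mul_idem hp hv hj.2.1⟩)
  refine ⟨ι, b, w, hbw, Submodule.ext fun x => (Iff.trans ?_ (hspan x).symm)⟩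
  constructor
  · rintro ⟨y, hy, rfl⟩
    obtain ⟨i, hi⟩ := (hmem y).1 hy
    obtain ⟨j, hij, hj⟩ := exists_ge_ge i i₀
    exact ⟨⟨j, hj⟩, (hhj ⟨j, hj⟩ _).1 ⟨y, hh hij hi, rfl⟩⟩
  · rintro ⟨j, hj⟩
    obtain ⟨y, hy, rfl⟩ := (hhj j x).2 hj
    exact ⟨y, (hmem y).2 ⟨j, hy⟩, rfl⟩

/-! ### The converse: simplicity of `sl n` and diagonal Cartan subalgebras -/

namespace IsDual

section Simple

variable {ι : Type*} [DecidableEq ι] [Fintype ι] {e : ι → V} {f : ι → W}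

/-- For `u = e b ⊗ f a` one has `u * u = 0`, so `[u, [u, x]] = -2 u x u`, and `u x u` is the given
coefficient times `u`. -/
theorem tmul_mem_of_coeff_ne_zero (h : IsDual p e f) {J : Submodule ℂ (MackeyGL p)}
    (hlie : ∀ x ∈ corner (idem p e f), ∀ y ∈ J, ⁅x, y⁆ ∈ J) {x : MackeyGL p} (hx : x ∈ J)
    {a b : ι} (hab : a ≠ b) (hc : p (actV p x (e b)) (f a) ≠ 0) : tmul p (e b) (f a) ∈ J := by
  have hu := h.tmul_mem_corner hab.symm
  have h1 := hlie _ hu _ (hlie _ hu _ hx)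
  have h2 : tmul p (e b) (f a) * tmul p (e b) (f a) = 0 := by
    rw [h.tmul_mul_tmul, if_neg hab.symm]
  have h3 : tmul p (e b) (f a) * (x * tmul p (e b) (f a)) =
      p (actV p x (e b)) (f a) • tmul p (e b) (f a) := by
    rw [mul_tmul, MackeyGL.tmul_mul_tmul]
  have h4 : ⁅tmul p (e b) (f a), ⁅tmul p (e b) (f a), x⁆⁆ =
      (-2 * p (actV p x (e b)) (f a)) • tmul p (e b) (f a) := by
    rw [mul_smul, ← h3]
    simp only [lie_def, mul_sub, sub_mul, mul_assoc, h2, mul_zero]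
    rw [← mul_assoc, h2, zero_mul]
    module
  rw [h4] at h1
  exact (Submodule.smul_mem_iff _ (mul_ne_zero (by norm_num) hc)).1 h1

/-- Brackets with units move one index at a time. The exceptional case `c = b` first passes to the
transposed unit by the double bracket. -/
theorem tmul_mem_of_tmul_mem (h : IsDual p e f) {J : Submodule ℂ (MackeyGL p)}
    (hlie : ∀ x ∈ corner (idem p e f), ∀ y ∈ J, ⁅x, y⁆ ∈ J) {a b : ι} (hab : a ≠ b)
    (hJ : tmul p (e a) (f b) ∈ J) {c d : ι} (hcd : c ≠ d) : tmul p (e c) (f d) ∈ J := by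
  have hR : ∀ {a b d}, a ≠ b → d ≠ a → tmul p (e a) (f b) ∈ J → tmul p (e a) (f d) ∈ J := by
    intro a b d hab hda hJ
    by_cases hdb : d = b
    · rwa [hdb]
    · have := hlie _ (h.tmul_mem_corner (Ne.symm hdb)) _ hJ
      rw [lie_def, h.tmul_mul_tmul, h.tmul_mul_tmul, if_pos rfl, if_neg hda.symm, zero_sub] at this
      exact neg_mem_iff.1 this
  by_cases hcb : c = b
  · subst hcb
    refine hR hab.symm hcd.symm (h.tmul_mem_of_coeff_ne_zero hlie hJ hab ?_)
    simp [h _ _]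
  · refine hR hcb hcd.symm ?_
    by_cases hca : c = a
    · rwa [hca]
    · have := hlie _ (h.tmul_mem_corner hca) _ hJ
      rwa [lie_def, h.tmul_mul_tmul, h.tmul_mul_tmul, if_pos rfl, if_neg hcb, sub_zero] at this

theorem eq_sum_diag {ι : Type*} [Fintype ι] {e : ι → V} {f : ι → W} {x : MackeyGL p} (hx : x ∈ corner (idem p e f))
    (hd : ∀ a b, a ≠ b → p (actV p x (e b)) (f a) = 0) :
    x = ∑ i, p (actV p x (e i)) (f i) • tmul p (e i) (f i) := by
  have h1 := idem_mul_mul_idem x e f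
  rw [hx.1, hx.2.1] at h1
  conv_lhs => rw [h1]
  refine Finset.sum_congr rfl fun i _ => Finset.sum_eq_single i (fun j _ hj => ?_) (by simp)
  rw [hd i j hj.symm, zero_smul]

/-- `sl n` has no nontrivial ideals. -/
theorem eq_bot_or_corner_le (h : IsDual p e f) {J : Submodule ℂ (MackeyGL p)}
    (hJ : J ≤ corner (idem p e f)) (hlie : ∀ x ∈ corner (idem p e f), ∀ y ∈ J, ⁅x, y⁆ ∈ J) :
    J = ⊥ ∨ corner (idem p e f) ≤ J := by
  rw [or_iff_not_imp_left]
  intro hne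
  obtain ⟨x, hx, hx0⟩ := Submodule.exists_mem_ne_zero_of_ne_bot hne
  obtain ⟨a, b, hab, hu⟩ : ∃ a b, a ≠ b ∧ tmul p (e a) (f b) ∈ J := by
    by_cases hd : ∀ a b, a ≠ b → p (actV p x (e b)) (f a) = 0
    · have hsum := eq_sum_diag (hJ hx) hd
      -- A nonzero traceless diagonal element is not scalar; bracketing a unit with it multiplies
      -- the unit by a difference of diagonal entries.
      obtain ⟨a, b, hab⟩ : ∃ a b, p (actV p x (e a)) (f a) ≠ p (actV p x (e b)) (f b) := by
        by_contra! hc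
        rcases isEmpty_or_nonempty ι with hι | ⟨⟨o⟩⟩
        · exact hx0 (by rw [hsum]; simp)
        · have h1 : ∀ i, p (actV p x (e i)) (f i) = p (actV p x (e o)) (f o) := fun i => hc i o
          have htr := (hJ hx).2.2
          rw [hsum] at htr
          simp only [map_sum, map_smul, h.tr_tmul, if_true, smul_eq_mul, mul_one] at htr
          simp only [h1, Finset.sum_const, nsmul_eq_mul, mul_eq_zero, Nat.cast_eq_zero,
            Finset.card_eq_zero, Finset.univ_eq_empty_iff] at htr
          rcases htr with htr | htr
          · exact htr.elim o
          · exact hx0 (by rw [hsum]; simp [h1, htr])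
      have hne : a ≠ b := fun hh => hab (by rw [hh])
      refine ⟨a, b, hne, ?_⟩
      have h2 := hlie _ (h.tmul_mem_corner hne) _ hx
      have h3 : ⁅tmul p (e a) (f b), x⁆ =
          (p (actV p x (e b)) (f b) - p (actV p x (e a)) (f a)) • tmul p (e a) (f b) := by
        rw [lie_def, sub_smul]
        congr 1
        · conv_lhs => rw [hsum]
          simp [Finset.mul_sum, mul_smul_comm, h.tmul_mul_tmul]
        · conv_lhs => rw [hsum]
          simp [Finset.sum_mul, smul_mul_assoc, h.tmul_mul_tmul]
      rw [h3] at h2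
      exact (Submodule.smul_mem_iff _ (sub_ne_zero.2 hab.symm)).1 h2
    · push Not at hd
      obtain ⟨a, b, hab, hc⟩ := hd
      exact ⟨b, a, hab.symm, h.tmul_mem_of_coeff_ne_zero hlie hx hab hc⟩
  refine h.corner_le (fun i j hij => h.tmul_mem_of_tmul_mem hlie hab hu hij) fun i j => ?_
  by_cases hij : i = j
  · subst hij; simp
  · have := hlie _ (h.tmul_mem_corner hij) _
      (h.tmul_mem_of_tmul_mem hlie hab hu (Ne.symm hij))
    simpa [lie_def, h.tmul_mul_tmul] using this

end Simple

end IsDual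

/-- The trace zero part of a corner, as a Lie subalgebra of `sl(V, W)`. -/
def cornerLie (E : MackeyGL p) : LieSubalgebra ℂ (MackeySL p) where
  __ := (corner E).comap (MackeySL p).toSubmodule.subtype
  lie_mem' hx hy := lie_mem_corner hx hy

theorem mem_cornerLie {E : MackeyGL p} {x : MackeySL p} :
    x ∈ cornerLie E ↔ (x : MackeyGL p) ∈ corner E := Iff.rfl

instance finiteDimensional_cornerLie {ι : Type*} [Fintype ι] (e : ι → V) (f : ι → W) :
    FiniteDimensional ℂ (cornerLie (idem p e f)) := by
  let S := Submodule.span ℂ (Set.range fun ij : ι × ι => tmul p (e ij.1) (f ij.2))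
  have : FiniteDimensional ℂ S := FiniteDimensional.span_of_finite ℂ (Set.finite_range _)
  have hS : ∀ x : cornerLie (idem p e f), ((x : MackeySL p) : MackeyGL p) ∈ S := by
    rintro ⟨x, hx⟩
    have h1 := idem_mul_mul_idem (x : MackeyGL p) e f
    rw [(mem_cornerLie.1 hx).1, (mem_cornerLie.1 hx).2.1] at h1
    change (x : MackeyGL p) ∈ S
    rw [h1]
    exact Submodule.sum_mem _ fun i _ => Submodule.sum_mem _ fun j _ =>
      Submodule.smul_mem _ _ (Submodule.subset_span ⟨(i, j), rfl⟩)
  refine FiniteDimensional.of_injective (LinearMap.codRestrict S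
    ((MackeySL p).toSubmodule.subtype ∘ₗ (cornerLie (idem p e f)).toSubmodule.subtype) hS) ?_
  intro x y hxy
  have hxy' := congrArg Subtype.val hxy
  exact Subtype.ext (Subtype.ext hxy')

theorem IsDual.isSimple_cornerLie {ι : Type*} [DecidableEq ι] [Fintype ι] [Nontrivial ι]
    {e : ι → V} {f : ι → W} (h : IsDual p e f) :
    LieAlgebra.IsSimple ℂ (cornerLie (idem p e f)) where
  eq_bot_or_eq_top I := by
    let φ := (MackeySL p).toSubmodule.subtype ∘ₗ (cornerLie (idem p e f)).toSubmodule.subtype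
    have hφ : Function.Injective φ := fun x y hxy => Subtype.ext (Subtype.ext hxy)
    rcases h.eq_bot_or_corner_le (J := I.toSubmodule.map φ)
      (by rintro _ ⟨y, -, rfl⟩; exact y.2)
      (by
        rintro x hx _ ⟨y, hy, rfl⟩
        exact ⟨⁅(⟨⟨x, hx.2.2⟩, hx⟩ : cornerLie (idem p e f)), y⁆, I.lie_mem hy, rfl⟩) with hI | hI
    · left
      rw [← LieSubmodule.toSubmodule_inj, LieSubmodule.bot_toSubmodule]
      exact Submodule.map_injective_of_injective hφ (by rw [hI, Submodule.map_bot])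
    · right
      rw [eq_top_iff]
      intro x _
      obtain ⟨y, hy, hyx⟩ := hI x.2
      exact hφ hyx ▸ hy
  non_abelian := by
    intro hab
    obtain ⟨a, b, hne⟩ := exists_pair_ne ι
    have h1 := h.tmul_mem_corner hne
    have h2 := h.tmul_mem_corner hne.symm
    have h3 := hab.trivial (⟨⟨_, h1.2.2⟩, h1⟩ : cornerLie (idem p e f)) ⟨⟨_, h2.2.2⟩, h2⟩
    have h4 : ⁅tmul p (e a) (f b), tmul p (e b) (f a)⁆ = 0 :=
      congrArg (fun x : cornerLie (idem p e f) => ((x : MackeySL p) : MackeyGL p)) h3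
    have h5 := congrArg (fun x => tr p (tmul p (e a) (f a) * x)) h4
    simp [lie_def, h.tmul_mul_tmul, mul_sub, h.tr_tmul, hne.symm] at h5

section Diagonal

variable {ι : Type*} [DecidableEq ι] {e : ι → V} {f : ι → W}

theorem IsDual.mul_comm_of_mem_span (h : IsDual p e f) {x y : MackeyGL p}
    (hx : x ∈ Submodule.span ℂ (Set.range fun i => tmul p (e i) (f i)))
    (hy : y ∈ Submodule.span ℂ (Set.range fun i => tmul p (e i) (f i))) : x * y = y * x := by
  induction hx using Submodule.span_induction with
  | mem x hx =>
    obtain ⟨i, rfl⟩ := hx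
    induction hy using Submodule.span_induction with
    | mem y hy =>
      obtain ⟨j, rfl⟩ := hy
      simp only [h.tmul_mul_tmul]
      by_cases hij : i = j
      · subst hij; rfl
      · rw [if_neg hij, if_neg (Ne.symm hij)]
    | zero => simp
    | add y z _ _ hy hz => rw [mul_add, add_mul, hy, hz]
    | smul c y _ hy => rw [mul_smul_comm, smul_mul_assoc, hy]
  | zero => simp
  | add y z _ _ hy hz => rw [mul_add, add_mul, hy, hz]
  | smul c y _ hy => rw [mul_smul_comm, smul_mul_assoc, hy]

theorem IsDual.coeff_eq_zero_of_mem_span (h : IsDual p e f) {x : MackeyGL p}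
    (hx : x ∈ Submodule.span ℂ (Set.range fun i => tmul p (e i) (f i))) {a b : ι} (hab : a ≠ b) :
    p (actV p x (e b)) (f a) = 0 := by
  induction hx using Submodule.span_induction with
  | mem x hx =>
    obtain ⟨i, rfl⟩ := hx
    by_cases hi : b = i
    · simp [h _ _, ← hi, hab.symm]
    · simp [h _ _, hi]
  | zero => simp
  | add y z _ _ hy hz => simp [hy, hz]
  | smul c y _ hy => simp [hy]

/-- The diagonal subalgebra of `sl(V, W)` with respect to a dual system. -/
def diagonal (h : IsDual p e f) : LieSubalgebra ℂ (MackeySL p) where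
  __ := (Submodule.span ℂ (Set.range fun i => tmul p (e i) (f i))).comap
    (MackeySL p).toSubmodule.subtype
  lie_mem' {x y} hx hy := by
    have hc : (x : MackeyGL p) * y = y * x := h.mul_comm_of_mem_span hx hy
    change ⁅(x : MackeyGL p), (y : MackeyGL p)⁆ ∈ Submodule.span ℂ _
    rw [lie_def, hc, sub_self]
    exact zero_mem _

/-- The idempotent of a finite part of a dual system. -/
def idemOn (p : V →ₗ[ℂ] W →ₗ[ℂ] ℂ) (e : ι → V) (f : ι → W) (s : Finset ι) : MackeyGL p :=
  idem p (fun i : s => e i) (fun i : s => f i)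

theorem IsDual.restrict (h : IsDual p e f) (s : Finset ι) :
    IsDual p (fun i : s => e i) (fun i : s => f i) := by
  exact fun i j => (h i j).trans (if_congr Subtype.ext_iff.symm rfl rfl)

theorem IsDual.idemOn_mul_tmul (h : IsDual p e f) {s : Finset ι} {i : ι} (hi : i ∈ s) (w : W) :
    idemOn p e f s * tmul p (e i) w = tmul p (e i) w :=
  (h.restrict s).idem_mul_tmul ⟨i, hi⟩ w

theorem IsDual.tmul_mul_idemOn (h : IsDual p e f) {s : Finset ι} {i : ι} (hi : i ∈ s) (v : V) :
    tmul p v (f i) * idemOn p e f s = tmul p v (f i) :=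
  (h.restrict s).tmul_mul_idem ⟨i, hi⟩ v

theorem IsDual.corner_idemOn_mono (h : IsDual p e f) {s t : Finset ι} (hst : s ⊆ t) :
    corner (idemOn p e f s) ≤ corner (idemOn p e f t) := by
  have h1 : idemOn p e f t * idemOn p e f s = idemOn p e f s := by
    conv_lhs => rhs; rw [idemOn, idem]
    rw [Finset.mul_sum]
    exact Finset.sum_congr rfl fun i _ => h.idemOn_mul_tmul (hst i.2) _
  have h2 : idemOn p e f s * idemOn p e f t = idemOn p e f s := by
    conv_lhs => lhs; rw [idemOn, idem]
    rw [Finset.sum_mul]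
    exact Finset.sum_congr rfl fun i _ => h.tmul_mul_idemOn (hst i.2) _
  rintro x ⟨hx, hx', htr⟩
  exact ⟨by rw [← hx, ← mul_assoc, h1], by rw [← hx', mul_assoc, h2], htr⟩

/-- The algebra is abelian. If `x` normalises it, the bracket of `x` with `e a ⊗ f a - e b ⊗ f b` is
diagonal, while its `(a, b)` entry is `-2` times that of `x`; so `x` is diagonal. -/
theorem IsDual.isCartanSubalgebra (h : IsDual p e f) (s : Finset ι) :
    ((diagonal h).comap (cornerLie (idemOn p e f s)).incl).IsCartanSubalgebra where
  nilpotent := by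
    have : IsLieAbelian ((diagonal h).comap (cornerLie (idemOn p e f s)).incl) :=
      ⟨fun x y => Subtype.ext <| Subtype.ext <| Subtype.ext <| by
        have hc : ((x.1.1 : MackeySL p) : MackeyGL p) * (y.1.1 : MackeySL p) =
            (y.1.1 : MackeySL p) * (x.1.1 : MackeySL p) := h.mul_comm_of_mem_span x.2 y.2
        change ⁅((x.1.1 : MackeySL p) : MackeyGL p), ((y.1.1 : MackeySL p) : MackeyGL p)⁆ = 0
        rw [lie_def, hc, sub_self]⟩
    infer_instance
  self_normalizing := by
    refine le_antisymm (fun x hx => ?_) (LieSubalgebra.le_normalizer _)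
    rw [LieSubalgebra.mem_normalizer_iff] at hx
    have hoff : ∀ a b : s, a ≠ b → p (actV p ((x : MackeySL p) : MackeyGL p) (e b)) (f a) = 0 := by
      intro a b hab
      have hab' : (a : ι) ≠ b := fun hh => hab (Subtype.ext hh)
      have hyc : tmul p (e a) (f a) - tmul p (e b) (f b) ∈ corner (idemOn p e f s) :=
        ⟨by rw [mul_sub, h.idemOn_mul_tmul a.2, h.idemOn_mul_tmul b.2],
          by rw [sub_mul, h.tmul_mul_idemOn a.2, h.tmul_mul_idemOn b.2], by simp [h.tr_tmul]⟩
      have hyd : tmul p (e a) (f a) - tmul p (e b) (f b) ∈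
          Submodule.span ℂ (Set.range fun i => tmul p (e i) (f i)) :=
        sub_mem (Submodule.subset_span ⟨a, rfl⟩) (Submodule.subset_span ⟨b, rfl⟩)
      have h1 := hx ⟨⟨_, hyc.2.2⟩, hyc⟩ hyd
      have h2 : p (actV p ⁅((x : MackeySL p) : MackeyGL p),
          tmul p (e a) (f a) - tmul p (e b) (f b)⁆ (e b)) (f a) = 0 :=
        h.coeff_eq_zero_of_mem_span h1 hab'
      simp [lie_def, actV_mul, h _ _, hab'.symm] at h2
      linear_combination (-1 / 2 : ℂ) * h2
    change ((x : MackeySL p) : MackeyGL p) ∈ Submodule.span ℂ _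
    have hxc : ((x : MackeySL p) : MackeyGL p) ∈ corner (idemOn p e f s) := x.2
    rw [eq_sum_diag hxc hoff]
    exact Submodule.sum_mem _ fun i _ => Submodule.smul_mem _ _ (Submodule.subset_span ⟨i, rfl⟩)

/-- The idempotents of finite parts are local units: each tensor involves only finitely many of the
spanning vectors. -/
theorem IsDual.exists_idemOn (h : IsDual p e f) (hV : Submodule.span ℂ (Set.range e) = ⊤)
    (hW : Submodule.span ℂ (Set.range f) = ⊤) (x : MackeyGL p) :
    ∃ s, ∀ t, s ⊆ t → idemOn p e f t * x = x ∧ x * idemOn p e f t = x := by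
  let S : Submodule ℂ (MackeyGL p) :=
    { carrier := {x | ∃ s, ∀ t, s ⊆ t → idemOn p e f t * x = x ∧ x * idemOn p e f t = x}
      zero_mem' := ⟨∅, fun t _ => by simp⟩
      add_mem' := by
        rintro x y ⟨s, hs⟩ ⟨s', hs'⟩
        refine ⟨s ∪ s', fun t ht => ?_⟩
        have h1 := hs t (Finset.union_subset_left ht)
        have h2 := hs' t (Finset.union_subset_right ht)
        rw [mul_add, add_mul, h1.1, h1.2, h2.1, h2.2]
        exact ⟨rfl, rfl⟩
      smul_mem' := by
        rintro c x ⟨s, hs⟩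
        refine ⟨s, fun t ht => ?_⟩
        rw [mul_smul_comm, smul_mul_assoc, (hs t ht).1, (hs t ht).2]
        exact ⟨rfl, rfl⟩ }
  change x ∈ S
  induction x using induction_on with
  | zero => exact zero_mem _
  | add x y hx hy => exact add_mem hx hy
  | tmul v w =>
    have hv : ⊤ ≤ S.comap ((tmulₗ p).flip w) := by
      rw [← hV, Submodule.span_le]
      rintro _ ⟨i, rfl⟩
      have hw : ⊤ ≤ S.comap (tmulₗ p (e i)) := by
        rw [← hW, Submodule.span_le]
        rintro _ ⟨j, rfl⟩
        exact ⟨{i, j}, fun t ht => ⟨h.idemOn_mul_tmul (ht (by simp)) _,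
          h.tmul_mul_idemOn (ht (by simp)) _⟩⟩
      exact hw (Submodule.mem_top (x := w))
    exact hv (Submodule.mem_top (x := v))

end Diagonal

/-- The diagonal subalgebra of a dual system that spans `V` and `W` is a local Cartan
subalgebra. -/
theorem IsDual.isLocalCartanSubalgebra_diagonal {ι : Type (max u v)} [DecidableEq ι] [Infinite ι]
    {e : ι → V} {f : ι → W} (h : IsDual p e f) (hV : Submodule.span ℂ (Set.range e) = ⊤)
    (hW : Submodule.span ℂ (Set.range f) = ⊤) : IsLocalCartanSubalgebra (diagonal h) := by
  obtain ⟨s₀, hs₀⟩ := Infinite.exists_subset_card_eq ι 2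
  have hex : ∀ x : MackeySL p, ∃ s : {s : Finset ι // 2 ≤ s.card},
      x ∈ cornerLie (idemOn p e f s) := by
    intro x
    obtain ⟨s, hs⟩ := h.exists_idemOn hV hW x
    obtain ⟨h1, h2⟩ := hs (s ∪ s₀) Finset.subset_union_left
    exact ⟨⟨s ∪ s₀, hs₀ ▸ Finset.card_le_card Finset.subset_union_right⟩, h1, h2, x.2⟩
  have hmono : Monotone fun s : {s : Finset ι // 2 ≤ s.card} => cornerLie (idemOn p e f s) :=
    fun s t hst x hx => h.corner_idemOn_mono hst hx
  -- At least two elements are required, since `sl 1` is zero and so not simple.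
  refine ⟨{s : Finset ι // 2 ≤ s.card}, inferInstance, ⟨⟨s₀, hs₀.ge⟩⟩, ⟨fun s t => ?_⟩,
    fun s => cornerLie (idemOn p e f s),
    fun s => (diagonal h).comap (cornerLie (idemOn p e f s)).incl,
    hmono, fun s => finiteDimensional_cornerLie _ _, fun s => ?_, hex,
    fun s => h.isCartanSubalgebra s, ?_, fun x => ⟨fun hx => ?_, ?_⟩⟩
  · exact ⟨⟨s ∪ t, s.2.trans (Finset.card_le_card Finset.subset_union_left)⟩,
      Finset.subset_union_left, Finset.subset_union_right⟩
  · have : Nontrivial (s : Finset ι) := by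
      rw [← Fintype.one_lt_card_iff_nontrivial, Fintype.card_coe]
      exact s.2
    exact (h.restrict s).isSimple_cornerLie
  · rintro s t hst _ ⟨y, hy, rfl⟩
    exact ⟨⟨y, hmono hst y.2⟩, hy, rfl⟩
  · obtain ⟨s, hs⟩ := hex x
    exact ⟨s, ⟨x, hs⟩, hx, rfl⟩
  · rintro ⟨s, y, hy, rfl⟩
    exact hy

end MackeyGL

theorem IsSpanningDualFamily.exists_isLocalCartanSubalgebra {V : Type u} {W : Type v}
    [AddCommGroup V] [Module ℂ V] [AddCommGroup W] [Module ℂ W] {p : V →ₗ[ℂ] W →ₗ[ℂ] ℂ}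
    (hV : ¬ FiniteDimensional ℂ V) {ι : Type u} {b : Module.Basis ι ℂ V} {w : ι → W}
    (h : IsSpanningDualFamily p b w) :
    ∃ H : LieSubalgebra ℂ (MackeySL p), IsLocalCartanSubalgebra H := by
  classical
  have hι : Infinite ι := by
    by_contra hfin
    rw [not_infinite_iff_finite] at hfin
    exact hV (Module.Finite.of_basis b)
  -- The index type of a local Cartan system lies in the universe of `V ⊗ W`, hence the lift.
  have hd : MackeyGL.IsDual p (fun i : ULift.{v} ι => b i.down) (fun i => w i.down) := by
    intro i j
    have h1 := LinearMap.congr_fun (h.1 j.down) (b i.down)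
    rw [LinearMap.flip_apply] at h1
    rw [h1]
    simp [Finsupp.single_apply, ULift.down_inj]
  have hr : ∀ {M : Type _} (g : ι → M), Set.range (fun i : ULift.{v} ι => g i.down) =
      Set.range g := fun g => ULift.down_surjective.range_comp g
  exact ⟨_, hd.isLocalCartanSubalgebra_diagonal (by rw [hr, b.span_eq])
    (by rw [← h.2]; exact congrArg _ (ULift.down_surjective.range_comp w))⟩

end

theorem mainTheorem9 {V : Type u} {W : Type v} [AddCommGroup V] [Module ℂ V] [AddCommGroup W]
    [Module ℂ W] (p : V →ₗ[ℂ] W →ₗ[ℂ] ℂ) (hp : p.Nondegenerate)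
    (hV : ¬ FiniteDimensional ℂ V) (hW : ¬ FiniteDimensional ℂ W) :
    ((∃ H : LieSubalgebra ℂ (MackeySL p), IsLocalCartanSubalgebra H) ↔
      ∃ (ι : Type u) (b : Module.Basis ι ℂ V) (w : ι → W), IsSpanningDualFamily p b w) ∧
    (∀ H : LieSubalgebra ℂ (MackeySL p), IsLocalCartanSubalgebra H →
      ∃ (ι : Type u) (b : Module.Basis ι ℂ V) (w : ι → W), IsSpanningDualFamily p b w ∧
        H.toSubmodule.map (MackeySL p).toSubmodule.subtype =
          Submodule.span ℂ (Set.range fun γ : ι × ι =>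
            MackeyGL.tmul p (b γ.1) (w γ.1) - MackeyGL.tmul p (b γ.2) (w γ.2))) := by
  have key := MackeyGL.exists_of_isLocalCartanSubalgebra hp hV hW
  refine ⟨⟨fun ⟨H, hH⟩ => ?_, fun ⟨ι, b, w, h⟩ => h.exists_isLocalCartanSubalgebra hV⟩, key⟩
  obtain ⟨ι, b, w, h, -⟩ := key H hH
  exact ⟨ι, b, w, h⟩
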